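/- Let $A\in\mathbb R^{n\times d}$ have rank $r$ and thin singular value decomposition $A=U\Sigma V^{\mathsf T}$ ($U^{\mathsf T}U=V^{\mathsf T}V=I_r$, $\Sigma=\mathrm{diag}(\sigma_1,\dots,\sigma_r)$, $\sigma_1\ge\dots\ge\sigma_r>0$), and let $1\le k<r$. Let $U_k$ consist of the first $k$ columns of $U$, let $A_k=U\,\mathrm{diag}(\sigma_1,\dots,\sigma_k,0,\dots,0)V^{\mathsf T}$ and $A_{k,\perp}=A-A_k$, and put $$p_i=\frac12\,\frac{\|(U_k)_{i*}\|_2^2}{k}+\frac12\,\frac{\|(A_{k,\perp})_{i*}\|_2^2}{\|A_{k,\perp}\|_F^2},\qquad i=1,\dots,n .$$ Then $p_i\ge 0$ and $\sum_i p_i=1$. Let $\varepsilon>0$, $\delta>0$, and let $s$ be an integer with $$s\ \ge\ \max\left\{\left(1+\frac{\varepsilon}{3}\right)\frac{4k\ln(16(1+k)/\delta)}{\varepsilon^2},\ \frac{8k}{\delta\varepsilon^2}\right\}.$$ Pick $j_1,\dots,j_s\in\{1,\dots,n\}$ independently with $\Pr(j_t=i)=p_i$, and let $W\in\mathbb R^{s\times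 n}$ be the sampling-and-rescaling matrix with $W_{t j_t}=(s\,p_{j_t})^{-1/2}$ and all other entries $0$. Let $\widetilde\Sigma=\mathrm{diag}(1,\dots,1,0,\dots,0)\in\mathbb R^{r\times r}$ with $k$ ones. Then, with probability at least $1-\delta$, the following hold simultaneously for all $X\in\mathbb R^{d\times(d-k)}$ with $X^{\mathsf T}X=I_{d-k}$: 1. $\|\widetilde\Sigma U^{\mathsf T}W^{\mathsf T}WU\widetilde\Sigma-\widetilde\Sigma^2\|_2\le\varepsilon$; 2. $\|\widetilde\Sigma U^{\mathsf T}W^{\mathsf T}WA_{k,\perp}-\widetilde\Sigma U^{\mathsf T}A_{k,\perp}\|_F\le\varepsilon\|AX\|_F$; 3. $\|A_{k,\perp}^{\mathsf T}W^{\mathsf T}WA_{k,\perp}-A_{k,\perp}^{\mathsf T}A_{k,\perp}\|_F\le\frac{\varepsilon}{\sqrt k}\|AX\|_F^2$; 4. $\bigl|\|WA_{k,\perp}\|_F^2-\|A_{k,\perp}\|_F^2\bigr|\le\varepsilon\|AX\|_F^2$; and $\bigl|\|WAX\|_F^2-\|AX\|_F^2\bigr|\le5\varepsilon\|AX\|_F^2$,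 that is, $WA$ is a rank-$k$ projection-cost preserving sketch of $A$ with error $5\varepsilon$. Moreover, for fixed $\delta$ the required number of rows is $O(k\ln k/\varepsilon^2)$: for every $\delta>0$ there is a constant $C>0$ depending only on $\delta$ such that for all $k\ge2$ and $0<\varepsilon\le1$ the least integer $s \geq 0$ satisfying the above bound is at most $C\,k\ln k/\varepsilon^2$. -/

import Mathlib

open MeasureTheory ProbabilityTheory
open scoped Matrix

noncomputable section

namespace PCP

/-- Frobenius norm of a real matrix. -/
def frobNorm {a b : ℕ} (M : Matrix (Fin a) (Fin b) ℝ) : ℝ :=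
  letI : NormedAddCommGroup (Matrix (Fin a) (Fin b) ℝ) := Matrix.frobeniusNormedAddCommGroup
  ‖M‖

/-- Spectral norm of a real matrix (operator norm between Euclidean spaces). -/
def specNorm {a b : ℕ} (M : Matrix (Fin a) (Fin b) ℝ) : ℝ :=
  letI : NormedAddCommGroup (Matrix (Fin a) (Fin b) ℝ) := Matrix.instL2OpNormedAddCommGroup
  ‖M‖

/-- `A = U diag(σ) Vᵀ` is a thin singular value decomposition: `U` and `V` have orthonormal columns
and `σ` lists the (positive) singular values in non-increasing order. The number `r` of columns is
then the rank of `A`. -/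
structure IsThinSVD {n d r : ℕ} (A : Matrix (Fin n) (Fin d) ℝ) (U : Matrix (Fin n) (Fin r) ℝ)
    (σ : Fin r → ℝ) (V : Matrix (Fin d) (Fin r) ℝ) : Prop where
  left_orthonormal : Uᵀ * U = 1
  right_orthonormal : Vᵀ * V = 1
  sigma_pos : ∀ j, 0 < σ j
  sigma_antitone : Antitone σ
  eq_mul : A = U * Matrix.diagonal σ * Vᵀ

/-- `U_k`: the first `k` columns of `U`. -/
def topCols {n r : ℕ} (U : Matrix (Fin n) (Fin r) ℝ) (k : ℕ) (hk : k ≤ r) :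
    Matrix (Fin n) (Fin k) ℝ :=
  U.submatrix id (Fin.castLE hk)

/-- `A_m = U Σ_m Vᵀ`, where `Σ_m = diag(σ₁, …, σ_m, 0, …, 0)`. -/
def truncation {n d r : ℕ} (U : Matrix (Fin n) (Fin r) ℝ) (σ : Fin r → ℝ)
    (V : Matrix (Fin d) (Fin r) ℝ) (m : ℕ) : Matrix (Fin n) (Fin d) ℝ :=
  U * Matrix.diagonal (fun j : Fin r => if (j : ℕ) < m then σ j else 0) * Vᵀ

/-- `A_{m,⊥} = A - A_m`. -/
def residual {n d r : ℕ} (A : Matrix (Fin n) (Fin d) ℝ) (U : Matrix (Fin n) (Fin r) ℝ)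
    (σ : Fin r → ℝ) (V : Matrix (Fin d) (Fin r) ℝ) (m : ℕ) : Matrix (Fin n) (Fin d) ℝ :=
  A - truncation U σ V m

/-- The `r × r` matrix `diag(1, …, 1, 0, …, 0)` with `k` ones. -/
def blockId (r k : ℕ) : Matrix (Fin r) (Fin r) ℝ :=
  Matrix.diagonal (fun j : Fin r => if (j : ℕ) < k then 1 else 0)

/-- The four structural conditions on the sketching matrix `W`, with `S` in the role of the
diagonal matrix `Σ̃` and `R` in the role of the residual `A_{m,⊥}`. -/
structure StructuralConditions {n d r s : ℕ} (k : ℕ) (ε : ℝ) (A : Matrix (Fin n) (Fin d) ℝ)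
    (U : Matrix (Fin n) (Fin r) ℝ) (S : Matrix (Fin r) (Fin r) ℝ) (R : Matrix (Fin n) (Fin d) ℝ)
    (W : Matrix (Fin s) (Fin n) ℝ) (X : Matrix (Fin d) (Fin (d - k)) ℝ) : Prop where
  cond₁ : specNorm (S * Uᵀ * Wᵀ * W * U * S - S ^ 2) ≤ ε
  cond₂ : frobNorm (S * Uᵀ * Wᵀ * W * R - S * Uᵀ * R) ≤ ε * frobNorm (A * X)
  cond₃ : frobNorm (Rᵀ * Wᵀ * W * R - Rᵀ * R) ≤ ε / √(k : ℝ) * frobNorm (A * X) ^ 2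
  cond₄ : |frobNorm (W * R) ^ 2 - frobNorm R ^ 2| ≤ ε * frobNorm (A * X) ^ 2

/-- `W * A` is a rank-`k` projection-cost preserving sketch of `A` with error `η`. -/
def IsProjectionCostPreserving {n d s : ℕ} (A : Matrix (Fin n) (Fin d) ℝ)
    (W : Matrix (Fin s) (Fin n) ℝ) (k : ℕ) (η : ℝ) : Prop :=
  ∀ X : Matrix (Fin d) (Fin (d - k)) ℝ, Xᵀ * X = 1 →
    |frobNorm (W * A * X) ^ 2 - frobNorm (A * X) ^ 2| ≤ η * frobNorm (A * X) ^ 2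

/-- Sampling probabilities
`p_i = ½ ‖(U_k)_{i*}‖² / k + ½ ‖(A_{k,⊥})_{i*}‖² / ‖A_{k,⊥}‖_F²`. -/
def samplingProb {n d r : ℕ} (A : Matrix (Fin n) (Fin d) ℝ) (U : Matrix (Fin n) (Fin r) ℝ)
    (σ : Fin r → ℝ) (V : Matrix (Fin d) (Fin r) ℝ) (k : ℕ) (hk : k ≤ r) (i : Fin n) : ℝ :=
  1 / 2 * ((∑ j, topCols U k hk i j ^ 2) / k) +
    1 / 2 * ((∑ j, residual A U σ V k i j ^ 2) / frobNorm (residual A U σ V k) ^ 2)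

/-- The sampling-and-rescaling matrix for the picks `j`: row `t` has the single entry
`(s p_{j_t})^{-1/2}`, in column `j_t`, and is zero elsewhere. -/
def samplingMatrix {n s : ℕ} (p : Fin n → ℝ) (j : Fin s → Fin n) : Matrix (Fin s) (Fin n) ℝ :=
  Matrix.of fun t a => if a = j t then (√((s : ℝ) * p (j t)))⁻¹ else 0

/-- The number of rows that suffices. -/
def sampleBound (k : ℕ) (ε δ : ℝ) : ℝ :=
  max ((1 + ε / 3) * (4 * k * Real.log (16 * (1 + k) / δ) / ε ^ 2)) (8 * k / (δ * ε ^ 2))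

end PCP

end

/-!
The matrix `WᵀW` is a sum of `s` independent rank-one diagonal terms, and its mean is the identity
on the rows that can be picked. A row that cannot be picked vanishes in `U_k` and in the residual, so
the products `BᵀWᵀWC` below are unbiased estimates of `BᵀC`. The proof separates what is random from
what depends on `X`.

*Deterministic part.* Write `R` for the residual of the rank-`k` truncation. By Eckart–Young
(`frobNorm_residual_le`), `‖R‖_F ≤ ‖AX‖_F` for every admissible `X`, so all four structural
conditions follow from four bounds stated in terms of `‖R‖_F` alone (`structuralConditions_of_le`).
The structural conditions give the error `5ε`: expanding `XᵀAᵀ(WᵀW - 1)AX` along `A = A_k + R`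
gives a quadratic term controlled by the spectral condition, a cross term, counted twice, and
`tr (Xᵀ E X)` with `E = Rᵀ(WᵀW - 1)R`. For the last one,
`tr (Xᵀ E X) = tr E - tr (E (1 - XXᵀ))`, and `1 - XXᵀ` is a projection of rank `k`, hence has
Frobenius norm `√k` (`StructuralConditions.abs_sub_le`).

*Frobenius bounds.* The sampling probabilities dominate the squared row norms of both `U_k` and `R`,
up to factors `2k` and `2‖R‖_F²`. Hence the variance of each sampled product is small
(`sum_prod_mul_frobNorm_sq_le`), and Chebyshev's inequality applies.

*Spectral bound.* This is a matrix Bernstein inequality (`matrix_bernstein`) in the manner of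
Ahlswede and Winter, whose only input beyond the spectral theorem is the Golden–Thompson inequality
`tr exp (A + B) ≤ tr (exp A * exp B)` (`trace_exp_add_le`). The latter is deduced from the
Lie–Trotter formula and the inequality `tr (PQ)^m ≤ tr (P^m Q^m)` for symmetric `P`, `Q` and `m` a
power of two (`trace_pow_two_pow_le`).

Only finitely many outcomes `j : Fin s → Fin n` occur, so probabilities and expectations are written
throughout as sums weighted by `∏ t, p (j t)`; `measureReal_picks_eq_sum_filter_prod` translates
them back.
-/

namespace PCP

/-! ### The Golden–Thompson inequality -/

section GoldenThompson

variable {m : Type*} [Fintype m]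

lemma trace_mul_transpose_self_nonneg (M : Matrix m m ℝ) : 0 ≤ (M * Mᵀ).trace := by
  simp only [Matrix.trace, Matrix.diag_apply, Matrix.mul_apply, Matrix.transpose_apply]
  exact Finset.sum_nonneg fun i _ => Finset.sum_nonneg fun j _ => mul_self_nonneg _

lemma trace_mul_self_le (M : Matrix m m ℝ) : (M * M).trace ≤ (M * Mᵀ).trace := by
  have h := trace_mul_transpose_self_nonneg (M - Mᵀ)
  have h1 : (Mᵀ * Mᵀ).trace = (M * M).trace := by
    rw [← Matrix.transpose_mul, Matrix.trace_transpose]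
  have h2 : (Mᵀ * M).trace = (M * Mᵀ).trace := Matrix.trace_mul_comm _ _
  simp only [Matrix.transpose_sub, Matrix.transpose_transpose, sub_mul, mul_sub,
    Matrix.trace_sub] at h
  linarith

lemma two_mul_trace_mul_le {P Q : Matrix m m ℝ} (hP : P.IsSymm) (hQ : Q.IsSymm) :
    2 * (P * Q).trace ≤ (P * P).trace + (Q * Q).trace := by
  have h := trace_mul_transpose_self_nonneg (P - Q)
  have h2 : (Q * P).trace = (P * Q).trace := Matrix.trace_mul_comm _ _
  simp only [Matrix.transpose_sub, hP.eq, hQ.eq, sub_mul, mul_sub, Matrix.trace_sub] at h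
  linarith

variable [DecidableEq m]

lemma trace_mul_pow_comm (A B : Matrix m m ℝ) (n : ℕ) :
    ((A * B) ^ n).trace = ((B * A) ^ n).trace := by
  cases n with
  | zero => simp
  | succ n =>
    have h : B * (A * B) ^ n = (B * A) ^ n * B :=
      (show SemiconjBy B (A * B) (B * A) by simp [SemiconjBy, mul_assoc]).pow_right n
    rw [pow_succ', mul_assoc, h, Matrix.trace_mul_comm, mul_assoc, ← pow_succ]

/-- The two inequalities are proved by a simultaneous induction on the exponent: doubling the
exponent in either of them uses both at the previous level. -/
lemma trace_pow_two_pow_le (j : ℕ) :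
    (∀ M : Matrix m m ℝ, (M ^ 2 ^ (j + 1)).trace ≤ ((M * Mᵀ) ^ 2 ^ j).trace) ∧
    ∀ P Q : Matrix m m ℝ, P.IsSymm → Q.IsSymm →
      ((P * Q) ^ 2 ^ j).trace ≤ (P ^ 2 ^ j * Q ^ 2 ^ j).trace := by
  induction j with
  | zero =>
    refine ⟨fun M => ?_, fun P Q _ _ => by simp⟩
    simpa [pow_two] using trace_mul_self_le M
  | succ j ih =>
    obtain ⟨ihM, ihPQ⟩ := ih
    refine ⟨fun M => ?_, fun P Q hP hQ => ?_⟩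
    · have hP : (Mᵀ * M).IsSymm := Matrix.isSymm_transpose_mul_self M
      have hQ : (M * Mᵀ).IsSymm := by simp [Matrix.IsSymm]
      calc (M ^ 2 ^ (j + 1 + 1)).trace = ((M * M) ^ 2 ^ (j + 1)).trace := by
            rw [← pow_two, ← pow_mul, ← pow_succ']
        _ ≤ (((M * M) * (M * M)ᵀ) ^ 2 ^ j).trace := ihM _
        _ = ((Mᵀ * M * (M * Mᵀ)) ^ 2 ^ j).trace := by
            rw [trace_mul_pow_comm (Mᵀ * M), Matrix.transpose_mul]
            rw [show M * M * (Mᵀ * Mᵀ) = (M * (M * Mᵀ)) * Mᵀ by simp [mul_assoc],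
              trace_mul_pow_comm, trace_mul_pow_comm (M * Mᵀ)]
            simp [mul_assoc]
        _ ≤ ((Mᵀ * M) ^ 2 ^ j * (M * Mᵀ) ^ 2 ^ j).trace := ihPQ _ _ hP hQ
        _ ≤ ((M * Mᵀ) ^ 2 ^ (j + 1)).trace := by
            have h := two_mul_trace_mul_le (hP.pow (2 ^ j)) (hQ.pow (2 ^ j))
            rw [← pow_two, ← pow_two, ← pow_mul, ← pow_mul, ← pow_succ,
              trace_mul_pow_comm Mᵀ M] at h
            linarith
    · calc ((P * Q) ^ 2 ^ (j + 1)).trace ≤ ((P * Q * (P * Q)ᵀ) ^ 2 ^ j).trace := ihM _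
        _ = ((P ^ 2 * Q ^ 2) ^ 2 ^ j).trace := by
            rw [Matrix.transpose_mul, hP.eq, hQ.eq, show P * Q * (Q * P) = P * Q ^ 2 * P by
              simp [pow_two, mul_assoc], trace_mul_pow_comm, ← mul_assoc, ← pow_two]
        _ ≤ ((P ^ 2) ^ 2 ^ j * (Q ^ 2) ^ 2 ^ j).trace := ihPQ _ _ (hP.pow 2) (hQ.pow 2)
        _ = (P ^ 2 ^ (j + 1) * Q ^ 2 ^ (j + 1)).trace := by
            rw [← pow_mul, ← pow_mul, ← pow_succ']

end GoldenThompson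

section LieTrotter

open NormedSpace Filter Topology

variable {𝔸 : Type*} [NormedRing 𝔸] [NormOneClass 𝔸]

lemma norm_pow_sub_pow_le {x y : 𝔸} {K : ℝ} (hK : 1 ≤ K) (hx : ‖x‖ ≤ K) (hy : ‖y‖ ≤ K) (n : ℕ) :
    ‖x ^ n - y ^ n‖ ≤ n * K ^ n * ‖x - y‖ := by
  have hK0 : 0 ≤ K := zero_le_one.trans hK
  induction n with
  | zero => simp
  | succ n ih =>
    have hyn : ‖y ^ n‖ ≤ K ^ n := (norm_pow_le y n).trans (by gcongr)
    calc ‖x ^ (n + 1) - y ^ (n + 1)‖ = ‖x * (x ^ n - y ^ n) + (x - y) * y ^ n‖ := by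
          congr 1; rw [pow_succ', pow_succ', mul_sub, sub_mul]; abel
      _ ≤ ‖x‖ * ‖x ^ n - y ^ n‖ + ‖x - y‖ * ‖y ^ n‖ :=
          (norm_add_le _ _).trans (add_le_add (norm_mul_le _ _) (norm_mul_le _ _))
      _ ≤ K * (n * K ^ n * ‖x - y‖) + ‖x - y‖ * K ^ (n + 1) := by
          have : K ^ n ≤ K ^ (n + 1) := pow_le_pow_right₀ hK n.le_succ
          gcongr
          exact hyn.trans this
      _ = (n + 1 : ℕ) * K ^ (n + 1) * ‖x - y‖ := by push_cast; ring

variable [NormedAlgebra ℝ 𝔸]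

lemma norm_exp_le (x : 𝔸) : ‖exp x‖ ≤ Real.exp ‖x‖ := by
  rw [Real.exp_eq_exp_ℝ, exp_eq_tsum ℝ, exp_eq_tsum ℝ]
  refine tsum_of_norm_bounded (expSeries_summable' (𝕂 := ℝ) ‖x‖).hasSum fun n => ?_
  rw [norm_smul, smul_eq_mul, norm_inv, RCLike.norm_natCast]
  gcongr
  exact norm_pow_le x n

variable [CompleteSpace 𝔸]

/-- The **Lie–Trotter product formula**. -/
lemma tendsto_exp_mul_exp_pow (a b : 𝔸) :
    Tendsto (fun n : ℕ => (exp ((n : ℝ)⁻¹ • a) * exp ((n : ℝ)⁻¹ • b)) ^ n) atTop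
      (𝓝 (exp (a + b))) := by
  set F : ℝ → 𝔸 := fun t => exp (t • a) * exp (t • b) - exp (t • (a + b)) with hF
  -- The error of a single step vanishes to first order, hence is `o(1/n)`.
  have hF' : HasDerivAt F 0 0 := by
    have h := ((hasDerivAt_exp_smul_const (𝕂 := ℝ) a 0).mul
      (hasDerivAt_exp_smul_const (𝕂 := ℝ) b 0)).sub
      (hasDerivAt_exp_smul_const (𝕂 := ℝ) (a + b) 0)
    simp only [zero_smul, exp_zero, mul_one, one_mul, sub_self] at h
    exact h
  have hlim : Tendsto (fun n : ℕ => (n : ℝ) * ‖F (n : ℝ)⁻¹‖) atTop (𝓝 0) := by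
    have h := (hasDerivAt_iff_tendsto.1 hF').comp
      (tendsto_inv_atTop_nhds_zero_nat (𝕜 := ℝ))
    refine h.congr fun n => ?_
    simp [hF]
  set K : ℝ := ‖a‖ + ‖b‖ with hKdef
  have hK : 0 ≤ K := by positivity
  rw [tendsto_iff_norm_sub_tendsto_zero]
  refine squeeze_zero' (Eventually.of_forall fun _ => norm_nonneg _) ?_
    (by simpa using hlim.const_mul (Real.exp K))
  filter_upwards [eventually_ge_atTop 1] with n hn
  have hn0 : (n : ℝ) ≠ 0 := by positivity
  have hexp : exp (a + b) = exp ((n : ℝ)⁻¹ • (a + b)) ^ n := by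
    let _ : NormedAlgebra ℚ 𝔸 := NormedAlgebra.restrictScalars ℚ ℝ 𝔸
    rw [← exp_nsmul, ← Nat.cast_smul_eq_nsmul ℝ, smul_smul, mul_inv_cancel₀ hn0, one_smul]
  have hsm : ∀ c : 𝔸, ‖(n : ℝ)⁻¹ • c‖ = ‖c‖ / n := fun c => by
    rw [norm_smul, norm_inv, RCLike.norm_natCast, inv_mul_eq_div]
  have hx : ‖exp ((n : ℝ)⁻¹ • a) * exp ((n : ℝ)⁻¹ • b)‖ ≤ Real.exp (K / n) := by
    refine (norm_mul_le _ _).trans ?_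
    rw [hKdef, add_div, Real.exp_add, ← hsm a, ← hsm b]
    gcongr <;> exact norm_exp_le _
  have hy : ‖exp ((n : ℝ)⁻¹ • (a + b))‖ ≤ Real.exp (K / n) := by
    refine (norm_exp_le _).trans (Real.exp_le_exp.2 ?_)
    rw [hsm]
    gcongr
    exact norm_add_le _ _
  have h := norm_pow_sub_pow_le (Real.one_le_exp (by positivity)) hx hy n
  rw [← Real.exp_nat_mul, mul_div_cancel₀ _ hn0, ← hexp] at h
  refine h.trans (le_of_eq ?_)
  simp only [hF]
  ring

end LieTrotter

section

open NormedSpace Filter Topology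

variable {m : Type*} [Fintype m] [DecidableEq m]

open scoped Matrix.Norms.Operator in
/-- The **Golden–Thompson inequality** for real symmetric matrices. -/
lemma trace_exp_add_le {A B : Matrix m m ℝ} (hA : A.IsSymm) (hB : B.IsSymm) :
    (exp (A + B)).trace ≤ (exp A * exp B).trace := by
  cases isEmpty_or_nonempty m
  · simp [Matrix.trace]
  have h2 : Tendsto (fun j : ℕ => 2 ^ j) atTop atTop :=
    tendsto_pow_atTop_atTop_of_one_lt one_lt_two
  have hcont : Continuous fun M : Matrix m m ℝ => M.trace := continuous_id.matrix_trace
  refine le_of_tendsto ((hcont.tendsto _).comp ((tendsto_exp_mul_exp_pow A B).comp h2))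
    (Eventually.of_forall fun j => ?_)
  have key := (trace_pow_two_pow_le j).2 (exp ((((2 ^ j : ℕ) : ℝ))⁻¹ • A))
    (exp ((((2 ^ j : ℕ) : ℝ))⁻¹ • B)) (Matrix.IsSymm.exp (hA.smul _))
    (Matrix.IsSymm.exp (hB.smul _))
  have hroot : ∀ C : Matrix m m ℝ, exp ((((2 ^ j : ℕ) : ℝ))⁻¹ • C) ^ 2 ^ j = exp C := fun C => by
    rw [← Matrix.exp_nsmul, ← Nat.cast_smul_eq_nsmul ℝ, smul_smul,
      mul_inv_cancel₀ (by positivity), one_smul]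
  rw [hroot, hroot] at key
  exact key

end

/-! ### Symmetric matrices: spectral decomposition and the exponential -/

section Spectral

open NormedSpace

variable {m : Type*} [Fintype m] [DecidableEq m]

lemma exists_orthogonal_diagonalization {Z : Matrix m m ℝ} (hZ : Z.IsSymm) :
    ∃ (U : Matrix m m ℝ) (l : m → ℝ), Uᵀ * U = 1 ∧ U * Uᵀ = 1 ∧
      Z = U * Matrix.diagonal l * Uᵀ := by
  have hH : Z.IsHermitian := by rwa [Matrix.IsHermitian, Matrix.conjTranspose_eq_transpose_of_trivial]
  have hstar : (star (hH.eigenvectorUnitary : Matrix m m ℝ)) =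
      (hH.eigenvectorUnitary : Matrix m m ℝ)ᵀ :=
    Matrix.conjTranspose_eq_transpose_of_trivial _
  refine ⟨hH.eigenvectorUnitary, hH.eigenvalues, ?_, ?_, ?_⟩
  · rw [← hstar]; exact Unitary.coe_star_mul_self _
  · rw [← hstar]; exact Unitary.coe_mul_star_self _
  · have h := hH.spectral_theorem
    rw [Unitary.conjStarAlgAut_apply, hstar] at h
    exact h

lemma exp_orthogonal_conj {U : Matrix m m ℝ} (h1 : Uᵀ * U = 1) (l : m → ℝ) :
    exp (U * Matrix.diagonal l * Uᵀ) = U * Matrix.diagonal (fun i => Real.exp (l i)) * Uᵀ := by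
  have hinv : U⁻¹ = Uᵀ := Matrix.inv_eq_left_inv h1
  have hu : IsUnit U := (Matrix.isUnit_iff_isUnit_det _).2 (Matrix.isUnit_det_of_left_inverse h1)
  have h := Matrix.exp_conj U (Matrix.diagonal l) hu
  rw [hinv, Matrix.exp_diagonal] at h
  rw [h]
  congr 3
  ext i
  rw [Pi.coe_exp, Real.exp_eq_exp_ℝ]

lemma posSemidef_orthogonal_conj_iff {U : Matrix m m ℝ} (h1 : Uᵀ * U = 1)
    (l : m → ℝ) : (U * Matrix.diagonal l * Uᵀ).PosSemidef ↔ ∀ i, 0 ≤ l i := by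
  constructor
  · intro h i
    have h' := h.conjTranspose_mul_mul_same U
    rw [Matrix.conjTranspose_eq_transpose_of_trivial, mul_assoc, mul_assoc, h1, mul_one,
      ← mul_assoc, h1, one_mul] at h'
    simpa using h'.diag_nonneg (i := i)
  · intro h
    have h' := (Matrix.PosSemidef.diagonal (R := ℝ) (d := l) h).mul_mul_conjTranspose_same U
    rwa [Matrix.conjTranspose_eq_transpose_of_trivial] at h'

lemma exp_le_one_add_add_sq {y b : ℝ} (hy : |y| ≤ b) (hb : b < 3) :
    Real.exp y ≤ 1 + y + 1 / (2 * (1 - b / 3)) * y ^ 2 := by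
  have hb0 : 0 ≤ b := (abs_nonneg y).trans hy
  have hexp : HasSum (fun n : ℕ => y ^ (n + 2) / (n + 2).factorial) (Real.exp y - (1 + y)) := by
    have h : HasSum (fun n : ℕ => y ^ n / n.factorial) (Real.exp y) := by
      rw [Real.exp_eq_exp_ℝ]; exact NormedSpace.expSeries_div_hasSum_exp y
    have h' := (hasSum_nat_add_iff' 2).2 h
    simpa [Finset.sum_range_succ] using h'
  have hgeom : HasSum (fun n : ℕ => y ^ 2 / 2 * (b / 3) ^ n) (y ^ 2 / 2 * (1 - b / 3)⁻¹) :=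
    (hasSum_geometric_of_lt_one (by positivity) (by linarith)).mul_left _
  -- `(n + 2)! ≥ 2 · 3ⁿ` compares the tail of the exponential series with a geometric series.
  have hfac : ∀ n : ℕ, (2 * 3 ^ n : ℝ) ≤ (n + 2).factorial := fun n => by
    have h := Nat.factorial_mul_pow_le_factorial (m := 2) (n := n)
    rw [add_comm n 2]
    exact_mod_cast h
  have hle := hasSum_le (fun n : ℕ => show y ^ (n + 2) / ((n + 2).factorial : ℝ) ≤
      y ^ 2 / 2 * (b / 3) ^ n from by
    calc y ^ (n + 2) / ((n + 2).factorial : ℝ) ≤ y ^ 2 * |y| ^ n / (n + 2).factorial := by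
          gcongr
          rw [pow_add, mul_comm, ← abs_pow y n]
          exact mul_le_mul_of_nonneg_left (le_abs_self _) (sq_nonneg y)
      _ ≤ y ^ 2 * b ^ n / (2 * 3 ^ n) := by
          gcongr
          exact hfac n
      _ = y ^ 2 / 2 * (b / 3) ^ n := by rw [div_pow]; field_simp) hexp hgeom
  have h3 : (1 - b / 3) ≠ 0 := by linarith
  have : y ^ 2 / 2 * (1 - b / 3)⁻¹ = 1 / (2 * (1 - b / 3)) * y ^ 2 := by field_simp
  linarith

/-- The scalar Bernstein bound `exp_le_one_add_add_sq`, transferred to symmetric matrices with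
spectrum in `[-b, b]`. -/
lemma posSemidef_one_add_add_sq_sub_exp {Z : Matrix m m ℝ} (hZ : Z.IsSymm) {b : ℝ} (hb : b < 3)
    (hu : (b • (1 : Matrix m m ℝ) - Z).PosSemidef) (hl : (b • (1 : Matrix m m ℝ) + Z).PosSemidef) :
    (1 + Z + (1 / (2 * (1 - b / 3))) • (Z * Z) - exp Z).PosSemidef := by
  obtain ⟨U, l, h1, h2, rfl⟩ := exists_orthogonal_diagonalization hZ
  have hone : (1 : Matrix m m ℝ) = U * Matrix.diagonal (fun _ => 1) * Uᵀ := by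
    rw [Matrix.diagonal_one, mul_one, h2]
  have hsq : U * Matrix.diagonal l * Uᵀ * (U * Matrix.diagonal l * Uᵀ) =
      U * Matrix.diagonal (fun i => l i * l i) * Uᵀ := by
    rw [← Matrix.diagonal_mul_diagonal]
    simp only [mul_assoc]
    rw [← mul_assoc Uᵀ U, h1, one_mul]
  have hup : ∀ i, l i ≤ b := by
    have : b • (1 : Matrix m m ℝ) - U * Matrix.diagonal l * Uᵀ =
        U * Matrix.diagonal (fun i => b - l i) * Uᵀ := by
      rw [← Matrix.diagonal_sub, mul_sub, sub_mul, ← Matrix.smul_one_eq_diagonal]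
      simp [h2]
    rw [this, posSemidef_orthogonal_conj_iff h1] at hu
    exact fun i => by linarith [hu i]
  have hlow : ∀ i, -b ≤ l i := by
    have : b • (1 : Matrix m m ℝ) + U * Matrix.diagonal l * Uᵀ =
        U * Matrix.diagonal (fun i => b + l i) * Uᵀ := by
      rw [← Matrix.diagonal_add, mul_add, add_mul, ← Matrix.smul_one_eq_diagonal]
      simp [h2]
    rw [this, posSemidef_orthogonal_conj_iff h1] at hl
    exact fun i => by linarith [hl i]
  have key : 1 + U * Matrix.diagonal l * Uᵀ + (1 / (2 * (1 - b / 3))) •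
      (U * Matrix.diagonal l * Uᵀ * (U * Matrix.diagonal l * Uᵀ)) - exp (U * Matrix.diagonal l * Uᵀ)
      = U * Matrix.diagonal (fun i => 1 + l i + 1 / (2 * (1 - b / 3)) * (l i * l i)
          - Real.exp (l i)) * Uᵀ := by
    rw [exp_orthogonal_conj h1, hsq]
    nth_rewrite 1 [hone]
    rw [← Matrix.diagonal_sub, ← Matrix.diagonal_add, ← Matrix.diagonal_add]
    simp only [mul_add, mul_sub, add_mul, sub_mul]
    congr 2
    rw [← Matrix.smul_mul, ← Matrix.mul_smul, ← Matrix.diagonal_smul]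
    rfl
  rw [key, posSemidef_orthogonal_conj_iff h1]
  intro i
  have := exp_le_one_add_add_sq (abs_le.2 ⟨hlow i, hup i⟩) hb
  rw [pow_two] at this
  linarith

lemma trace_exp_mul_nonneg {H Q : Matrix m m ℝ} (hH : H.IsSymm) (hQ : Q.PosSemidef) :
    0 ≤ (exp H * Q).trace := by
  have hE : (exp ((1 / 2 : ℝ) • H)).IsSymm := Matrix.IsSymm.exp (hH.smul _)
  have hHE : exp H = exp ((1 / 2 : ℝ) • H) * exp ((1 / 2 : ℝ) • H) := by
    rw [← Matrix.exp_add_of_commute _ _ (Commute.refl _), ← add_smul]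
    norm_num
  rw [hHE, mul_assoc, Matrix.trace_mul_comm]
  have h := (hQ.mul_mul_conjTranspose_same (exp ((1 / 2 : ℝ) • H))).trace_nonneg
  rwa [Matrix.conjTranspose_eq_transpose_of_trivial, hE.eq] at h

lemma trace_exp_nonneg {H : Matrix m m ℝ} (hH : H.IsSymm) : 0 ≤ (exp H).trace := by
  simpa using trace_exp_mul_nonneg hH Matrix.PosSemidef.one

open scoped Matrix.Norms.L2Operator in
lemma l2_opNorm_le_one_of_transpose_mul_self {n : Type*} [Fintype n]
    {U : Matrix n m ℝ} (h : Uᵀ * U = 1) : ‖U‖ ≤ 1 := by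
  have h1 : ‖(1 : Matrix m m ℝ)‖ ≤ 1 := by
    rw [← Matrix.diagonal_one, Matrix.l2_opNorm_diagonal, pi_norm_le_iff_of_nonneg zero_le_one]
    simp
  have h2 := Matrix.l2_opNorm_conjTranspose_mul_self U
  rw [Matrix.conjTranspose_eq_transpose_of_trivial, h] at h2
  nlinarith [norm_nonneg U]

open scoped Matrix.Norms.L2Operator in
/-- The exponential Markov step: if `‖Z‖ > a`, then `Z` or `-Z` has an eigenvalue above `a`, which
the trace of the exponential detects. -/
lemma exp_le_trace_exp_add_trace_exp_neg {Z : Matrix m m ℝ} (hZ : Z.IsSymm) {τ a : ℝ}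
    (hτ : 0 ≤ τ) (ha : 0 ≤ a) (h : a < ‖Z‖) :
    Real.exp (τ * a) ≤ (exp (τ • Z)).trace + (exp (τ • -Z)).trace := by
  obtain ⟨U, l, h1, h2, rfl⟩ := exists_orthogonal_diagonalization hZ
  have hU : ‖U‖ ≤ 1 := l2_opNorm_le_one_of_transpose_mul_self h1
  have hUt : ‖Uᵀ‖ ≤ 1 := l2_opNorm_le_one_of_transpose_mul_self (by simpa using h2)
  have hnorm : ‖U * Matrix.diagonal l * Uᵀ‖ ≤ ‖l‖ := by
    calc _ ≤ ‖U‖ * ‖Matrix.diagonal l‖ * ‖Uᵀ‖ :=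
          (Matrix.l2_opNorm_mul _ _).trans (by gcongr; exact Matrix.l2_opNorm_mul _ _)
      _ ≤ 1 * ‖l‖ * 1 := by rw [Matrix.l2_opNorm_diagonal]; gcongr
      _ = ‖l‖ := by ring
  obtain ⟨i, hi⟩ : ∃ i, a < |l i| := by
    by_contra! hcon
    exact absurd ((pi_norm_le_iff_of_nonneg ha).2 hcon) (not_le.2 (h.trans_le hnorm))
  have htr : ∀ c : ℝ, (exp (c • (U * Matrix.diagonal l * Uᵀ))).trace =
      ∑ i, Real.exp (c * l i) := fun c => by
    rw [← Matrix.smul_mul, ← Matrix.mul_smul, ← Matrix.diagonal_smul, exp_orthogonal_conj h1,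
      mul_assoc, Matrix.trace_mul_comm, mul_assoc, h1, mul_one, Matrix.trace_diagonal]
    rfl
  have hpos : ∀ c : ℝ, Real.exp (c * l i) ≤ ∑ i, Real.exp (c * l i) := fun c =>
    Finset.single_le_sum (f := fun i => Real.exp (c * l i)) (fun _ _ => (Real.exp_pos _).le)
      (Finset.mem_univ i)
  have hnn : ∀ c : ℝ, 0 ≤ ∑ i, Real.exp (c * l i) := fun c =>
    Finset.sum_nonneg fun _ _ => (Real.exp_pos _).le
  rw [smul_neg, ← neg_smul, htr, htr]
  rcases lt_abs.1 hi with hi | hi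
  · have : Real.exp (τ * a) ≤ Real.exp (τ * l i) := Real.exp_le_exp.2 (by gcongr)
    linarith [hpos τ, hnn (-τ)]
  · have : Real.exp (τ * a) ≤ Real.exp (-τ * l i) := Real.exp_le_exp.2 (by nlinarith)
    linarith [hpos (-τ), hnn τ]

end Spectral

/-! ### A matrix Bernstein inequality for independent picks from a finite set -/

section Bernstein

open NormedSpace

variable {α : Type*} [Fintype α]

lemma sum_prod_mul_fin_succ (p : α → ℝ) {s : ℕ} (F : (Fin (s + 1) → α) → ℝ) :
    ∑ j, (∏ t, p (j t)) * F j =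
      ∑ a, p a * ∑ j : Fin s → α, (∏ t, p (j t)) * F (Fin.cons a j) := by
  rw [← (Fin.consEquiv fun _ => α).sum_comp, Fintype.sum_prod_type]
  refine Finset.sum_congr rfl fun a _ => ?_
  rw [Finset.mul_sum]
  refine Finset.sum_congr rfl fun j _ => ?_
  simp [Fin.consEquiv, Fin.prod_univ_succ, mul_assoc]

lemma sum_prod_eq_one {p : α → ℝ} (hp : ∑ a, p a = 1) (s : ℕ) :
    ∑ j : Fin s → α, ∏ t, p (j t) = 1 := by
  have h := Finset.prod_univ_sum (fun _ : Fin s => (Finset.univ : Finset α)) fun _ a => p a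
  rw [Fintype.piFinset_univ] at h
  simp [← h, hp]

variable {m : Type*} [Fintype m] [DecidableEq m]

/-- The Ahlswede–Winter iteration: Golden–Thompson peels off one independent summand at a time. -/
lemma sum_prod_mul_trace_exp_le {p : α → ℝ} (hp : ∀ a, 0 ≤ p a) {X : α → Matrix m m ℝ}
    (hX : ∀ a, (X a).IsSymm) {c : ℝ} (hc : 0 ≤ c)
    (hbound : (c • (1 : Matrix m m ℝ) - ∑ a, p a • exp (X a)).PosSemidef) (s : ℕ) :
    ∀ {H : Matrix m m ℝ}, H.IsSymm →
      ∑ j : Fin s → α, (∏ t, p (j t)) * (exp (H + ∑ t, X (j t))).trace ≤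
        c ^ s * (exp H).trace := by
  induction s with
  | zero => intro H _; simp
  | succ s ih =>
    intro H hH
    rw [sum_prod_mul_fin_succ p (fun j => (exp (H + ∑ t, X (j t))).trace)]
    have h1 : ∑ a, p a * (exp H * exp (X a)).trace ≤ c * (exp H).trace := by
      have h := trace_exp_mul_nonneg hH hbound
      simp only [mul_sub, Matrix.trace_sub, Matrix.mul_sum, Matrix.mul_smul, Matrix.trace_smul,
        Matrix.trace_sum, mul_one, smul_eq_mul] at h
      linarith
    calc ∑ a, p a * ∑ j : Fin s → α, (∏ t, p (j t)) *
          (exp (H + ∑ t, X ((Fin.cons a j : Fin (s + 1) → α) t))).trace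
        ≤ ∑ a, p a * (c ^ s * (exp H * exp (X a)).trace) := by
          refine Finset.sum_le_sum fun a _ => mul_le_mul_of_nonneg_left ?_ (hp a)
          simp only [Fin.sum_univ_succ, Fin.cons_zero, Fin.cons_succ, ← add_assoc]
          refine (ih (hH.add (hX a))).trans ?_
          gcongr
          exact trace_exp_add_le hH (hX a)
      _ = c ^ s * ∑ a, p a * (exp H * exp (X a)).trace := by
          rw [Finset.mul_sum]
          exact Finset.sum_congr rfl fun a _ => by ring
      _ ≤ c ^ s * (c * (exp H).trace) := by gcongr
      _ = c ^ (s + 1) * (exp H).trace := by ring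

lemma sum_prod_mul_trace_exp_smul_le {p : α → ℝ} (hp : ∀ a, 0 ≤ p a) (hp1 : ∑ a, p a = 1)
    {X : α → Matrix m m ℝ} (hX : ∀ a, (X a).IsSymm) (hmean : ∑ a, p a • X a = 0) {L v τ : ℝ}
    (hu : ∀ a, (L • (1 : Matrix m m ℝ) - X a).PosSemidef)
    (hl : ∀ a, (L • (1 : Matrix m m ℝ) + X a).PosSemidef)
    (hv : (v • (1 : Matrix m m ℝ) - ∑ a, p a • (X a * X a)).PosSemidef) (hv0 : 0 ≤ v)
    (hτ : 0 ≤ τ) (hτL : τ * L < 3) (s : ℕ) :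
    ∑ j : Fin s → α, (∏ t, p (j t)) * (exp (τ • ∑ t, X (j t))).trace ≤
      Fintype.card m * Real.exp (s * (τ ^ 2 * v / (2 * (1 - τ * L / 3)))) := by
  have h3 : 0 < 1 - τ * L / 3 := by linarith
  set κ : ℝ := 1 / (2 * (1 - τ * L / 3)) with hκ
  have hκ0 : 0 ≤ κ := by positivity
  have hstep : ∀ a, (1 + τ • X a + (κ * τ ^ 2) • (X a * X a) - exp (τ • X a)).PosSemidef := by
    intro a
    have h := posSemidef_one_add_add_sq_sub_exp ((hX a).smul τ) hτL
      (by have := (hu a).smul hτ; rwa [smul_sub, smul_smul] at this)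
      (by have := (hl a).smul hτ; rwa [smul_add, smul_smul] at this)
    rwa [Matrix.smul_mul, Matrix.mul_smul, smul_smul, smul_smul, ← hκ,
      show κ * τ * τ = κ * τ ^ 2 by ring] at h
  have hbound : ((1 + κ * τ ^ 2 * v) • (1 : Matrix m m ℝ) -
      ∑ a, p a • exp (τ • X a)).PosSemidef := by
    have h1 := Matrix.posSemidef_sum Finset.univ fun a _ => (hstep a).smul (hp a)
    have h2 := h1.add (hv.smul (show 0 ≤ κ * τ ^ 2 by positivity))
    convert h2 using 1
    simp only [smul_add, smul_sub, Finset.sum_add_distrib, Finset.sum_sub_distrib,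
      ← Finset.sum_smul, hp1, Finset.smul_sum, smul_comm _ τ, smul_comm _ (κ * τ ^ 2)]
    rw [← Finset.smul_sum, hmean, add_smul, smul_zero, smul_smul]
    abel
  have h := sum_prod_mul_trace_exp_le hp (fun a => (hX a).smul τ) (by positivity) hbound s
    (H := 0) Matrix.isSymm_zero
  simp only [zero_add, ← Finset.smul_sum, NormedSpace.exp_zero, Matrix.trace_one] at h
  refine h.trans ?_
  rw [mul_comm, Real.exp_nat_mul]
  gcongr
  have hr : τ ^ 2 * v / (2 * (1 - τ * L / 3)) = κ * τ ^ 2 * v := by rw [hκ]; ring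
  rw [hr, add_comm]
  exact Real.add_one_le_exp _

open scoped Matrix.Norms.L2Operator in
/-- **Matrix Bernstein inequality** for `s` independent picks from a finite set with
probabilities `p`: `L` bounds the summands and `v` the variance of one summand. -/
lemma matrix_bernstein {p : α → ℝ} (hp : ∀ a, 0 ≤ p a) (hp1 : ∑ a, p a = 1)
    {X : α → Matrix m m ℝ} (hX : ∀ a, (X a).IsSymm) (hmean : ∑ a, p a • X a = 0) {L v ε : ℝ}
    (hu : ∀ a, (L • (1 : Matrix m m ℝ) - X a).PosSemidef)
    (hl : ∀ a, (L • (1 : Matrix m m ℝ) + X a).PosSemidef)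
    (hv : (v • (1 : Matrix m m ℝ) - ∑ a, p a • (X a * X a)).PosSemidef) (hv0 : 0 < v)
    (hL : 0 ≤ L) (hε : 0 < ε) (s : ℕ) :
    ∑ j : Fin s → α with s * ε < ‖∑ t, X (j t)‖, ∏ t, p (j t) ≤
      2 * Fintype.card m * Real.exp (-(s * ε ^ 2 / (2 * (v + L * ε / 3)))) := by
  set D : ℝ := v + L * ε / 3 with hD
  have hD0 : 0 < D := by positivity
  -- The optimal parameter in the exponential Markov inequality.
  set τ : ℝ := ε / D with hτ
  have hτ0 : 0 ≤ τ := by positivity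
  have hτL : τ * L < 3 := by
    rw [hτ, div_mul_eq_mul_div, div_lt_iff₀ hD0, hD]; nlinarith
  have hvD : 1 - τ * L / 3 = v / D := by
    rw [hτ]; field_simp; rw [hD]; ring
  have hρ : τ ^ 2 * v / (2 * (1 - τ * L / 3)) = ε ^ 2 / (2 * D) := by
    rw [hvD, hτ]; field_simp
  have h1 := sum_prod_mul_trace_exp_smul_le hp hp1 hX hmean hu hl hv hv0.le hτ0 hτL s
  have h2 := sum_prod_mul_trace_exp_smul_le hp hp1 (X := fun a => -X a) (fun a => (hX a).neg)
    (by simp [hmean]) (by simpa using hl) (by simpa [← sub_eq_add_neg] using hu)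
    (by simpa using hv) hv0.le hτ0 hτL s
  rw [hρ] at h1 h2
  have hw : ∀ j : Fin s → α, 0 ≤ ∏ t, p (j t) := fun j => Finset.prod_nonneg fun t _ => hp _
  have hsymm : ∀ j : Fin s → α, (∑ t, X (j t)).IsSymm := fun j => by
    rw [Matrix.IsSymm, Matrix.transpose_sum]
    exact Finset.sum_congr rfl fun t _ => (hX _).eq
  have h3 : (∑ j : Fin s → α with s * ε < ‖∑ t, X (j t)‖, ∏ t, p (j t)) *
      Real.exp (τ * (s * ε)) ≤ ∑ j : Fin s → α, (∏ t, p (j t)) *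
        ((exp (τ • ∑ t, X (j t))).trace + (exp (τ • -∑ t, X (j t))).trace) := by
    rw [Finset.sum_mul]
    refine (Finset.sum_le_sum fun j hj => ?_).trans (Finset.sum_le_univ_sum_of_nonneg fun j => ?_)
    · exact mul_le_mul_of_nonneg_left (exp_le_trace_exp_add_trace_exp_neg (hsymm j) hτ0
        (by positivity) (Finset.mem_filter.1 hj).2) (hw j)
    · exact mul_nonneg (hw j) (add_nonneg (trace_exp_nonneg ((hsymm j).smul _))
        (trace_exp_nonneg ((hsymm j).neg.smul _)))
  simp only [mul_add, Finset.sum_add_distrib] at h3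
  simp only [Finset.sum_neg_distrib] at h2
  have h4 := h3.trans (add_le_add h1 h2)
  rw [← le_div_iff₀ (Real.exp_pos _)] at h4
  refine h4.trans (le_of_eq ?_)
  have h5 : -(s * ε ^ 2 / (2 * D)) = s * (ε ^ 2 / (2 * D)) - τ * (s * ε) := by
    rw [hτ]; field_simp; ring
  rw [h5, Real.exp_sub]
  ring

end Bernstein

/-! ### The Frobenius norm and the spectral norm -/

section Norms

variable {a b c : ℕ}

lemma frobNorm_nonneg (M : Matrix (Fin a) (Fin b) ℝ) : 0 ≤ frobNorm M :=
  let _ : NormedAddCommGroup (Matrix (Fin a) (Fin b) ℝ) := Matrix.frobeniusNormedAddCommGroup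
  norm_nonneg M

lemma frobNorm_sq (M : Matrix (Fin a) (Fin b) ℝ) : frobNorm M ^ 2 = ∑ i, ∑ j, M i j ^ 2 := by
  have h : frobNorm M = (∑ i, ∑ j, ‖M i j‖ ^ (2 : ℝ)) ^ (1 / 2 : ℝ) := Matrix.frobenius_norm_def M
  simp only [Real.rpow_two, Real.norm_eq_abs, sq_abs] at h
  rw [h, ← Real.sqrt_eq_rpow, Real.sq_sqrt]
  exact Finset.sum_nonneg fun _ _ => Finset.sum_nonneg fun _ _ => sq_nonneg _

lemma frobNorm_sq_eq_trace (M : Matrix (Fin a) (Fin b) ℝ) :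
    frobNorm M ^ 2 = (Mᵀ * M).trace := by
  rw [frobNorm_sq, Finset.sum_comm]
  simp [Matrix.trace, Matrix.mul_apply, pow_two]

lemma abs_trace_transpose_mul_le (M N : Matrix (Fin a) (Fin b) ℝ) :
    |(Mᵀ * N).trace| ≤ frobNorm M * frobNorm N := by
  refine abs_le_of_sq_le_sq ?_ (mul_nonneg (frobNorm_nonneg M) (frobNorm_nonneg N))
  have htr : (Mᵀ * N).trace = ∑ x : Fin a × Fin b, M x.1 x.2 * N x.1 x.2 := by
    rw [Fintype.sum_prod_type, Finset.sum_comm]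
    simp [Matrix.trace, Matrix.mul_apply]
  rw [mul_pow, frobNorm_sq, frobNorm_sq, htr, ← Fintype.sum_prod_type', ← Fintype.sum_prod_type']
  exact Finset.sum_mul_sq_le_sq_mul_sq _ _ _

open scoped Matrix.Norms.L2Operator in
lemma frobNorm_mul_le (E : Matrix (Fin a) (Fin b) ℝ) (Y : Matrix (Fin b) (Fin c) ℝ) :
    frobNorm (E * Y) ≤ specNorm E * frobNorm Y := by
  have hE : 0 ≤ specNorm E := norm_nonneg E
  refine le_of_sq_le_sq ?_ (mul_nonneg hE (frobNorm_nonneg Y))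
  rw [mul_pow, frobNorm_sq, frobNorm_sq, Finset.sum_comm,
    Finset.sum_comm (f := fun i j => Y i j ^ 2), Finset.mul_sum]
  refine Finset.sum_le_sum fun j _ => ?_
  have h := Matrix.l2_opNorm_mulVec E (WithLp.toLp 2 (Y.col j))
  have h' := pow_le_pow_left₀ (norm_nonneg _) h 2
  rw [mul_pow, EuclideanSpace.norm_sq_eq, EuclideanSpace.norm_sq_eq] at h'
  simpa [Matrix.mulVec, dotProduct, Matrix.mul_apply, specNorm] using h'

lemma abs_trace_transpose_mul_mul_le (E : Matrix (Fin a) (Fin a) ℝ) (Y : Matrix (Fin a) (Fin b) ℝ) :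
    |(Yᵀ * E * Y).trace| ≤ specNorm E * frobNorm Y ^ 2 := by
  rw [Matrix.mul_assoc]
  calc _ ≤ frobNorm Y * frobNorm (E * Y) := abs_trace_transpose_mul_le _ _
    _ ≤ frobNorm Y * (specNorm E * frobNorm Y) :=
        mul_le_mul_of_nonneg_left (frobNorm_mul_le E Y) (frobNorm_nonneg Y)
    _ = specNorm E * frobNorm Y ^ 2 := by ring

end Norms

/-! ### The best rank-`k` approximation and the structural conditions -/

section Deterministic

variable {n d r : ℕ} {A : Matrix (Fin n) (Fin d) ℝ} {U : Matrix (Fin n) (Fin r) ℝ} {σ : Fin r → ℝ}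
  {V : Matrix (Fin d) (Fin r) ℝ} {k : ℕ}

lemma residual_eq (h : IsThinSVD A U σ V) (k : ℕ) : residual A U σ V k =
    U * Matrix.diagonal (fun j : Fin r => if (j : ℕ) < k then 0 else σ j) * Vᵀ := by
  rw [residual, truncation, h.eq_mul, ← Matrix.sub_mul, ← Matrix.mul_sub, Matrix.diagonal_sub]
  congr 3
  ext j
  split_ifs <;> simp

lemma frobNorm_sq_residual (h : IsThinSVD A U σ V) (k : ℕ) : frobNorm (residual A U σ V k) ^ 2 =
    ∑ j : Fin r, if (j : ℕ) < k then 0 else σ j ^ 2 := by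
  rw [frobNorm_sq_eq_trace, residual_eq h, Matrix.transpose_mul, Matrix.transpose_mul,
    Matrix.transpose_transpose, Matrix.diagonal_transpose]
  set D := Matrix.diagonal (fun j : Fin r => if (j : ℕ) < k then 0 else σ j)
  rw [show V * (D * Uᵀ) * (U * D * Vᵀ) = V * (D * (Uᵀ * U) * D * Vᵀ) by simp only [Matrix.mul_assoc],
    h.left_orthonormal, Matrix.trace_mul_comm, Matrix.mul_assoc, h.right_orthonormal, Matrix.mul_one, Matrix.mul_one,
    Matrix.diagonal_mul_diagonal, Matrix.trace_diagonal]
  refine Finset.sum_congr rfl fun j _ => ?_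
  split_ifs <;> ring

lemma frobNorm_residual_pos (h : IsThinSVD A U σ V) (hkr : k < r) :
    0 < frobNorm (residual A U σ V k) := by
  have h2 : 0 < frobNorm (residual A U σ V k) ^ 2 := by
    rw [frobNorm_sq_residual h]
    refine Finset.sum_pos' (fun j _ => ?_) ⟨⟨k, hkr⟩, Finset.mem_univ _, ?_⟩
    · split_ifs
      exacts [le_rfl, sq_nonneg _]
    · simpa using pow_pos (h.sigma_pos _) 2
  exact (frobNorm_nonneg _).lt_of_ne fun h0 => by simp [← h0] at h2

section Projection

variable {X : Matrix (Fin d) (Fin (d - k)) ℝ}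

lemma complement_isSymm (X : Matrix (Fin d) (Fin (d - k)) ℝ) : (1 - X * Xᵀ)ᵀ = 1 - X * Xᵀ := by
  simp

lemma complement_mul_self (hX : Xᵀ * X = 1) :
    (1 - X * Xᵀ)ᵀ * (1 - X * Xᵀ) = 1 - X * Xᵀ := by
  rw [complement_isSymm, Matrix.mul_sub, Matrix.sub_mul, Matrix.sub_mul,
    show X * Xᵀ * (X * Xᵀ) = X * (Xᵀ * X) * Xᵀ by simp only [Matrix.mul_assoc], hX]
  simp

lemma trace_complement (hX : Xᵀ * X = 1) (hkd : k ≤ d) : (1 - X * Xᵀ).trace = (k : ℝ) := by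
  rw [Matrix.trace_sub, Matrix.trace_mul_comm, hX, Matrix.trace_one, Matrix.trace_one,
    Fintype.card_fin, Fintype.card_fin, Nat.cast_sub hkd]
  ring

lemma frobNorm_complement (hX : Xᵀ * X = 1) (hkd : k ≤ d) :
    frobNorm (1 - X * Xᵀ) = √(k : ℝ) := by
  have h : frobNorm (1 - X * Xᵀ) ^ 2 = (k : ℝ) := by
    rw [frobNorm_sq_eq_trace, complement_mul_self hX, trace_complement hX hkd]
  exact (Real.sqrt_sq (frobNorm_nonneg _)).symm.trans (congrArg Real.sqrt h)

lemma IsThinSVD.rank_le (h : IsThinSVD A U σ V) : r ≤ d := by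
  have h1 : (1 : Matrix (Fin r) (Fin r) ℝ).rank ≤ V.rank := by
    rw [← h.right_orthonormal]
    exact Matrix.rank_mul_le_right _ _
  rw [Matrix.rank_one, Fintype.card_fin] at h1
  exact h1.trans (Matrix.rank_le_height V)

/-- **Eckart–Young** in the Frobenius norm: the residual of the truncated singular value
decomposition is the smallest rank-`k` projection cost. -/
lemma frobNorm_residual_le (h : IsThinSVD A U σ V) (hkr : k < r) (hX : Xᵀ * X = 1) :
    frobNorm (residual A U σ V k) ≤ frobNorm (A * X) := by
  refine le_of_sq_le_sq ?_ (frobNorm_nonneg _)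
  have hkd : k ≤ d := hkr.le.trans h.rank_le
  set Q := 1 - X * Xᵀ with hQ
  have hQQ : Qᵀ * Q = Q := complement_mul_self hX
  -- `e j` is the squared length of the component of the `j`-th right singular vector outside
  -- the column space of `X`; these lie in `[0, 1]` and sum to at most `k`.
  set e : Fin r → ℝ := fun j => (Vᵀ * Q * V) j j with he
  have hVQV : Vᵀ * Q * V = (Q * V)ᵀ * (Q * V) := by
    rw [Matrix.transpose_mul, show Vᵀ * Qᵀ * (Q * V) = Vᵀ * (Qᵀ * Q) * V by simp only [Matrix.mul_assoc], hQQ]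
  have he0 : ∀ j, 0 ≤ e j := fun j => by
    change 0 ≤ (Vᵀ * Q * V) j j
    rw [hVQV, Matrix.mul_apply]
    exact Finset.sum_nonneg fun i _ => mul_self_nonneg _
  have hce : ∀ j, ((Vᵀ * X) * (Vᵀ * X)ᵀ) j j = 1 - e j := fun j => by
    have : (Vᵀ * X) * (Vᵀ * X)ᵀ = 1 - Vᵀ * Q * V := by
      rw [hQ, Matrix.mul_sub, Matrix.sub_mul, Matrix.mul_one, h.right_orthonormal, sub_sub_cancel, Matrix.transpose_mul,
        Matrix.transpose_transpose]
      simp only [Matrix.mul_assoc]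
    rw [this, Matrix.sub_apply, Matrix.one_apply_eq]
  have he1 : ∀ j, e j ≤ 1 := fun j => by
    have : 0 ≤ ((Vᵀ * X) * (Vᵀ * X)ᵀ) j j := by
      rw [Matrix.mul_apply]
      exact Finset.sum_nonneg fun i _ => mul_self_nonneg _
    linarith [hce j]
  have hesum : ∑ j, e j ≤ k := by
    have h1 : ∑ j, e j = (Q * (V * Vᵀ)).trace := by
      change (Vᵀ * Q * V).trace = _
      rw [Matrix.mul_assoc, Matrix.trace_mul_comm, Matrix.mul_assoc]
    have h2 : 0 ≤ (Q * (1 - V * Vᵀ)).trace := by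
      have hT : (1 - V * Vᵀ)ᵀ * (1 - V * Vᵀ) = 1 - V * Vᵀ := by
        simp only [Matrix.transpose_sub, Matrix.transpose_mul, Matrix.transpose_transpose,
          Matrix.transpose_one, Matrix.mul_sub, Matrix.sub_mul, Matrix.mul_one, Matrix.one_mul]
        rw [show V * Vᵀ * (V * Vᵀ) = V * (Vᵀ * V) * Vᵀ by simp only [Matrix.mul_assoc],
          h.right_orthonormal]
        simp
      rw [← hT, ← hQQ, ← Matrix.mul_assoc, Matrix.trace_mul_comm,
        show (1 - V * Vᵀ) * (Qᵀ * Q * (1 - V * Vᵀ)ᵀ) =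
          (Q * (1 - V * Vᵀ)ᵀ)ᵀ * (Q * (1 - V * Vᵀ)ᵀ) by
          simp only [Matrix.transpose_mul, Matrix.transpose_transpose, Matrix.mul_assoc],
        ← frobNorm_sq_eq_trace]
      exact sq_nonneg _
    rw [Matrix.mul_sub, Matrix.mul_one, Matrix.trace_sub, hQ, trace_complement hX hkd] at h2
    linarith
  have hAX : frobNorm (A * X) ^ 2 = ∑ j, σ j ^ 2 * (1 - e j) := by
    rw [frobNorm_sq_eq_trace, h.eq_mul]
    have : (U * Matrix.diagonal σ * Vᵀ * X)ᵀ * (U * Matrix.diagonal σ * Vᵀ * X) =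
        (Vᵀ * X)ᵀ * (Matrix.diagonal σ * (Uᵀ * U) * Matrix.diagonal σ * (Vᵀ * X)) := by
      simp only [Matrix.transpose_mul, Matrix.transpose_transpose, Matrix.diagonal_transpose,
        Matrix.mul_assoc]
    rw [this, h.left_orthonormal, Matrix.mul_one, Matrix.diagonal_mul_diagonal, Matrix.trace_mul_comm,
      Matrix.mul_assoc]
    simp only [Matrix.trace, Matrix.diag_apply, Matrix.diagonal_mul, hce]
    exact Finset.sum_congr rfl fun j _ => by ring
  rw [hAX, frobNorm_sq_residual h]
  set μ : ℝ := σ ⟨k, hkr⟩ ^ 2 with hμ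
  have hterm : ∀ j : Fin r, μ * ((if (j : ℕ) < k then 1 else 0) - e j) ≤
      σ j ^ 2 * (1 - e j) - (if (j : ℕ) < k then 0 else σ j ^ 2) := fun j => by
    split_ifs with hj
    · have : μ ≤ σ j ^ 2 :=
        pow_le_pow_left₀ (h.sigma_pos _).le (h.sigma_antitone (Fin.le_def.2 hj.le)) 2
      nlinarith [he1 j]
    · have : σ j ^ 2 ≤ μ :=
        pow_le_pow_left₀ (h.sigma_pos _).le (h.sigma_antitone (Fin.le_def.2 (not_lt.1 hj))) 2
      nlinarith [he0 j]
  have hcard : ∑ j : Fin r, (if (j : ℕ) < k then (1 : ℝ) else 0) = k := by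
    rw [Finset.sum_boole, Fin.card_filter_val_lt, min_eq_right hkr.le]
  have hsum := Finset.sum_le_sum fun j (_ : j ∈ Finset.univ) => hterm j
  rw [← Finset.mul_sum, Finset.sum_sub_distrib, Finset.sum_sub_distrib, hcard] at hsum
  have : 0 ≤ μ * (k - ∑ j, e j) := mul_nonneg (sq_nonneg _) (by linarith)
  linarith

/-- The structural conditions control the three parts of `XᵀAᵀ(WᵀW - 1)AX` obtained by splitting
`A` into its truncation and its residual. -/
lemma StructuralConditions.abs_sub_le {s : ℕ} {W : Matrix (Fin s) (Fin n) ℝ} {ε : ℝ}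
    (h : IsThinSVD A U σ V) (hk : 1 ≤ k) (hkr : k < r) (hε : 0 < ε) (hX : Xᵀ * X = 1)
    (hW : StructuralConditions k ε A U (blockId r k) (residual A U σ V k) W X) :
    |frobNorm (W * A * X) ^ 2 - frobNorm (A * X) ^ 2| ≤ 5 * ε * frobNorm (A * X) ^ 2 := by
  have hkd : k ≤ d := hkr.le.trans h.rank_le
  obtain ⟨c1, c2, c3, c4⟩ := hW
  set R := residual A U σ V k with hR
  set S := blockId r k with hS
  set Dk := Matrix.diagonal (fun j : Fin r => if (j : ℕ) < k then σ j else 0) with hDk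
  set Y := Dk * Vᵀ * X with hY
  set c := frobNorm (A * X) with hc
  have hc0 : 0 ≤ c := frobNorm_nonneg _
  have hST : Sᵀ = S := Matrix.diagonal_transpose _
  have hSD : S * Dk = Dk := by
    rw [hS, blockId, hDk, Matrix.diagonal_mul_diagonal]
    congr 1
    ext j
    split_ifs <;> simp
  have hSY : S * Y = Y := by rw [hY, ← Matrix.mul_assoc, ← Matrix.mul_assoc, hSD]
  have hAX : A * X = U * Y + R * X := by
    rw [hR, residual, truncation, Matrix.sub_mul, hY]
    simp only [Matrix.mul_assoc]
    abel
  have hUR : Yᵀ * Uᵀ * R = 0 := by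
    have : Dk * Matrix.diagonal (fun j : Fin r => if (j : ℕ) < k then 0 else σ j) = 0 := by
      rw [hDk, Matrix.diagonal_mul_diagonal, ← Matrix.diagonal_zero]
      congr 1
      ext j
      split_ifs <;> simp
    rw [hR, residual_eq h, hY, Matrix.transpose_mul, Matrix.transpose_mul, hDk,
      Matrix.diagonal_transpose, ← hDk]
    set E := Matrix.diagonal (fun j : Fin r => if (j : ℕ) < k then 0 else σ j)
    rw [show Xᵀ * (Vᵀᵀ * Dk) * Uᵀ * (U * E * Vᵀ) = Xᵀ * Vᵀᵀ * (Dk * (Uᵀ * U) * E) * Vᵀ by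
      simp only [Matrix.mul_assoc], h.left_orthonormal, Matrix.mul_one, this]
    simp
  -- The truncation and the residual are orthogonal, so the truncated part costs no more than `A`.
  have hYc : frobNorm Y ≤ c := by
    refine le_of_sq_le_sq ?_ hc0
    have h1 : (A * X)ᵀ * (A * X) = Yᵀ * (Uᵀ * U) * Y + Yᵀ * Uᵀ * R * X + (Yᵀ * Uᵀ * R * X)ᵀ +
        (R * X)ᵀ * (R * X) := by
      rw [hAX]
      simp only [Matrix.transpose_add, Matrix.transpose_mul, Matrix.transpose_transpose, Matrix.add_mul,
        Matrix.mul_add, Matrix.mul_assoc]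
      abel
    rw [hUR, h.left_orthonormal, Matrix.mul_one] at h1
    rw [hc, frobNorm_sq_eq_trace (A * X), h1]
    simp only [Matrix.zero_mul, Matrix.transpose_zero, add_zero, Matrix.trace_add]
    rw [← frobNorm_sq_eq_trace, ← frobNorm_sq_eq_trace]
    linarith [sq_nonneg (frobNorm (R * X))]
  have hYXT : frobNorm (Y * Xᵀ) = frobNorm Y := by
    rw [← sq_eq_sq₀ (frobNorm_nonneg _) (frobNorm_nonneg _), frobNorm_sq_eq_trace,
      frobNorm_sq_eq_trace, Matrix.transpose_mul, Matrix.transpose_transpose, Matrix.trace_mul_comm,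
      show Y * Xᵀ * (X * Yᵀ) = Y * (Xᵀ * X) * Yᵀ by simp only [Matrix.mul_assoc], hX, Matrix.mul_one,
      Matrix.trace_mul_comm]
  set E1 := S * Uᵀ * Wᵀ * W * U * S - S ^ 2 with hE1
  set E2 := S * Uᵀ * Wᵀ * W * R - S * Uᵀ * R with hE2
  set E3 := Rᵀ * Wᵀ * W * R - Rᵀ * R with hE3
  have hYS : Yᵀ * S = Yᵀ := by rw [← hST, ← Matrix.transpose_mul, hSY]
  have hsplit : frobNorm (W * A * X) ^ 2 - c ^ 2 =
      (Yᵀ * E1 * Y).trace + 2 * ((Y * Xᵀ)ᵀ * E2).trace + (Xᵀ * E3 * X).trace := by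
    have e1 : Yᵀ * E1 * Y = Yᵀ * Uᵀ * Wᵀ * W * U * Y - Yᵀ * (Uᵀ * U) * Y := by
      rw [h.left_orthonormal, Matrix.mul_one, hE1, Matrix.mul_sub, Matrix.sub_mul, pow_two,
        show Yᵀ * (S * S) * Y = (Yᵀ * S) * (S * Y) by simp only [Matrix.mul_assoc],
        show Yᵀ * (S * Uᵀ * Wᵀ * W * U * S) * Y = (Yᵀ * S) * Uᵀ * Wᵀ * W * U * (S * Y) by
          simp only [Matrix.mul_assoc], hYS, hSY]
    have e2 : ((Y * Xᵀ)ᵀ * E2).trace =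
        (Yᵀ * Uᵀ * Wᵀ * W * R * X).trace - (Yᵀ * Uᵀ * R * X).trace := by
      rw [Matrix.transpose_mul, Matrix.transpose_transpose, Matrix.mul_assoc, Matrix.trace_mul_comm, hE2,
        Matrix.mul_sub, Matrix.sub_mul, Matrix.trace_sub,
        show Yᵀ * (S * Uᵀ * Wᵀ * W * R) * X = (Yᵀ * S) * Uᵀ * Wᵀ * W * R * X by
          simp only [Matrix.mul_assoc],
        show Yᵀ * (S * Uᵀ * R) * X = (Yᵀ * S) * Uᵀ * R * X by simp only [Matrix.mul_assoc], hYS]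
    have e2' : (Xᵀ * Rᵀ * Wᵀ * W * U * Y).trace = (Yᵀ * Uᵀ * Wᵀ * W * R * X).trace := by
      rw [← Matrix.trace_transpose]
      simp only [Matrix.transpose_mul, Matrix.transpose_transpose, Matrix.mul_assoc]
    have e2'' : (Xᵀ * Rᵀ * U * Y).trace = (Yᵀ * Uᵀ * R * X).trace := by
      rw [← Matrix.trace_transpose]
      simp only [Matrix.transpose_mul, Matrix.transpose_transpose, Matrix.mul_assoc]
    rw [e1, e2, hc, frobNorm_sq_eq_trace, frobNorm_sq_eq_trace, Matrix.mul_assoc W A X, hAX, hE3]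
    simp only [Matrix.transpose_add, Matrix.transpose_mul, Matrix.add_mul, Matrix.mul_add, Matrix.mul_sub, Matrix.sub_mul,
      Matrix.trace_add, Matrix.trace_sub, ← Matrix.mul_assoc]
    rw [e2', e2'']
    ring
  have b1 : |(Yᵀ * E1 * Y).trace| ≤ ε * c ^ 2 :=
    (abs_trace_transpose_mul_mul_le E1 Y).trans
      (mul_le_mul c1 (pow_le_pow_left₀ (frobNorm_nonneg _) hYc 2) (sq_nonneg _) hε.le)
  have b2 : |((Y * Xᵀ)ᵀ * E2).trace| ≤ ε * c ^ 2 := by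
    refine (abs_trace_transpose_mul_le _ _).trans ?_
    rw [hYXT]
    calc frobNorm Y * frobNorm E2 ≤ c * (ε * c) :=
          mul_le_mul hYc c2 (frobNorm_nonneg _) hc0
      _ = ε * c ^ 2 := by ring
  have b3 : |(Xᵀ * E3 * X).trace| ≤ 2 * ε * c ^ 2 := by
    have h1 : (Xᵀ * E3 * X).trace = E3.trace - ((1 - X * Xᵀ)ᵀ * E3).trace := by
      rw [complement_isSymm, Matrix.sub_mul, Matrix.one_mul, Matrix.trace_sub E3, sub_sub_cancel, Matrix.mul_assoc,
        Matrix.trace_mul_comm, Matrix.mul_assoc, Matrix.trace_mul_comm]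
    have h2 : E3.trace = frobNorm (W * R) ^ 2 - frobNorm R ^ 2 := by
      rw [frobNorm_sq_eq_trace, frobNorm_sq_eq_trace, hE3, Matrix.trace_sub, Matrix.transpose_mul]
      simp only [Matrix.mul_assoc]
    have h3 : |((1 - X * Xᵀ)ᵀ * E3).trace| ≤ ε * c ^ 2 := by
      refine (abs_trace_transpose_mul_le _ _).trans ?_
      have hk0 : 0 < √(k : ℝ) := Real.sqrt_pos.2 (by exact_mod_cast hk)
      rw [frobNorm_complement hX hkd]
      calc √(k : ℝ) * frobNorm E3 ≤ √(k : ℝ) * (ε / √(k : ℝ) * c ^ 2) := by gcongr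
        _ = ε * c ^ 2 := by field_simp
    rw [h1]
    rw [← h2] at c4
    calc _ ≤ |E3.trace| + |((1 - X * Xᵀ)ᵀ * E3).trace| := abs_sub _ _
      _ ≤ 2 * ε * c ^ 2 := by linarith
  rw [hsplit, abs_le]
  rw [abs_le] at b1 b2 b3
  constructor <;> linarith

end Projection

end Deterministic

/-! ### Second moments of the sampled products -/

section SecondMoment

variable {α : Type*} [Fintype α]

/-- The second moment of a sum of independent centred terms; the shift `c` absorbs the first term
in the induction on the number of terms. -/
lemma sum_prod_mul_add_sum_sq {p f : α → ℝ} (hp1 : ∑ a, p a = 1) (hf : ∑ a, p a * f a = 0) (s : ℕ) :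
    ∀ c : ℝ, ∑ j : Fin s → α, (∏ t, p (j t)) * (c + ∑ t, f (j t)) ^ 2 =
      c ^ 2 + s * ∑ a, p a * f a ^ 2 := by
  induction s with
  | zero => intro c; simp
  | succ s ih =>
    intro c
    rw [sum_prod_mul_fin_succ p fun j => (c + ∑ t, f (j t)) ^ 2]
    simp only [Fin.sum_univ_succ, Fin.cons_zero, Fin.cons_succ, ← add_assoc, ih]
    calc ∑ a, p a * ((c + f a) ^ 2 + s * ∑ a, p a * f a ^ 2)
        = ∑ a, (p a * (c ^ 2 + s * ∑ a, p a * f a ^ 2) + 2 * c * (p a * f a) + p a * f a ^ 2) :=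
          Finset.sum_congr rfl fun a _ => by ring
      _ = _ := by
          rw [Finset.sum_add_distrib, Finset.sum_add_distrib, ← Finset.sum_mul, hp1,
            ← Finset.mul_sum, hf]
          push_cast
          ring

lemma sum_prod_mul_sum_sub_mean_sq_le {p : α → ℝ} (hp1 : ∑ a, p a = 1) (f : α → ℝ) (s : ℕ) :
    ∑ j : Fin s → α, (∏ t, p (j t)) * (∑ t, f (j t) - s * ∑ a, p a * f a) ^ 2 ≤
      s * ∑ a, p a * f a ^ 2 := by
  set μ := ∑ a, p a * f a with hμ
  have h := sum_prod_mul_add_sum_sq (f := fun a => f a - μ) hp1 (by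
    simp only [mul_sub, Finset.sum_sub_distrib, ← Finset.sum_mul, hp1, ← hμ, one_mul, sub_self]) s 0
  have hvar : ∑ a, p a * (f a - μ) ^ 2 = ∑ a, p a * f a ^ 2 - μ ^ 2 := by
    calc ∑ a, p a * (f a - μ) ^ 2
        = ∑ a, (p a * f a ^ 2 - 2 * μ * (p a * f a) + p a * μ ^ 2) :=
          Finset.sum_congr rfl fun a _ => by ring
      _ = _ := by
          rw [Finset.sum_add_distrib, Finset.sum_sub_distrib, ← Finset.sum_mul, hp1,
            ← Finset.mul_sum, ← hμ]
          ring
  simp only [Finset.sum_sub_distrib, Finset.sum_const, Finset.card_univ, Fintype.card_fin,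
    nsmul_eq_mul, zero_add, hvar] at h
  rw [h]
  nlinarith [mul_nonneg (Nat.cast_nonneg (α := ℝ) s) (sq_nonneg μ)]

lemma sum_filter_prod_le_div {p : α → ℝ} (hp : ∀ a, 0 ≤ p a) {s : ℕ} {F : (Fin s → α) → ℝ}
    (hF : ∀ j, 0 ≤ F j) {T : ℝ} (hT : 0 < T) {bad : (Fin s → α) → Prop} [DecidablePred bad]
    (hbad : ∀ j, bad j → T ≤ F j) :
    ∑ j with bad j, ∏ t, p (j t) ≤ (∑ j, (∏ t, p (j t)) * F j) / T := by
  have hw : ∀ j : Fin s → α, 0 ≤ ∏ t, p (j t) := fun j => Finset.prod_nonneg fun t _ => hp _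
  rw [le_div_iff₀ hT, Finset.sum_mul]
  refine (Finset.sum_le_sum fun j hj => ?_).trans
    (Finset.sum_le_univ_sum_of_nonneg fun j => mul_nonneg (hw j) (hF j))
  exact mul_le_mul_of_nonneg_left (hbad j (Finset.mem_filter.1 hj).2) (hw j)

end SecondMoment

/-! ### Products with the sampling matrix -/

section Sampling

variable {n s b c k : ℕ} {p : Fin n → ℝ}

lemma samplingMatrix_mul_apply (p : Fin n → ℝ) (j : Fin s → Fin n) (C : Matrix (Fin n) (Fin c) ℝ)
    (t : Fin s) (y : Fin c) :
    (samplingMatrix p j * C) t y = (√((s : ℝ) * p (j t)))⁻¹ * C (j t) y := by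
  simp [samplingMatrix, Matrix.mul_apply]

lemma transpose_mul_samplingMatrix_mul_apply (hp : ∀ i, 0 ≤ p i) (j : Fin s → Fin n)
    (B : Matrix (Fin n) (Fin b) ℝ) (C : Matrix (Fin n) (Fin c) ℝ) (x : Fin b) (y : Fin c) :
    (Bᵀ * (samplingMatrix p j)ᵀ * samplingMatrix p j * C) x y =
      ∑ t, B (j t) x * C (j t) y / (s * p (j t)) := by
  rw [← Matrix.transpose_mul, Matrix.mul_assoc, Matrix.mul_apply]
  refine Finset.sum_congr rfl fun t _ => ?_
  rw [Matrix.transpose_apply, samplingMatrix_mul_apply, samplingMatrix_mul_apply,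
    mul_mul_mul_comm, ← mul_inv, Real.mul_self_sqrt (mul_nonneg (Nat.cast_nonneg s) (hp _))]
  ring

/-- Approximate matrix multiplication: the mean squared Frobenius error of the sampled product
`BᵀWᵀWC`, when the sampling probabilities dominate the squared row norms of `B`. -/
lemma sum_prod_mul_frobNorm_sq_le (hp : ∀ i, 0 ≤ p i) (hp1 : ∑ i, p i = 1) (hs : 0 < s)
    {κ : ℝ} (hκ : 0 ≤ κ) {B : Matrix (Fin n) (Fin b) ℝ} (hB : ∀ i, ∑ x, B i x ^ 2 ≤ κ * p i)
    (C : Matrix (Fin n) (Fin c) ℝ) :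
    ∑ j : Fin s → Fin n, (∏ t, p (j t)) *
        frobNorm (Bᵀ * (samplingMatrix p j)ᵀ * samplingMatrix p j * C - Bᵀ * C) ^ 2 ≤
      κ / s * frobNorm C ^ 2 := by
  have hs0 : (0 : ℝ) < s := by exact_mod_cast hs
  -- The row `i` is never picked, and vanishes in `B`, when `p i = 0`.
  have hB0 : ∀ i, p i = 0 → ∀ x, B i x = 0 := fun i hi x => by
    have h1 := (Finset.single_le_sum (f := fun x => B i x ^ 2) (fun _ _ => sq_nonneg _)
      (Finset.mem_univ x)).trans (hB i)
    rw [hi, mul_zero] at h1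
    exact pow_eq_zero_iff two_ne_zero |>.1 (le_antisymm h1 (sq_nonneg _))
  have hmean : ∀ x y, (Bᵀ * C) x y = s * ∑ i, p i * (B i x * C i y / (s * p i)) := fun x y => by
    rw [Matrix.mul_apply, Finset.mul_sum]
    refine Finset.sum_congr rfl fun i _ => ?_
    rcases eq_or_ne (p i) 0 with hi | hi
    · simp [hB0 i hi]
    · rw [Matrix.transpose_apply]
      field_simp
  have hentry : ∀ x y, ∑ j : Fin s → Fin n, (∏ t, p (j t)) *
      ((Bᵀ * (samplingMatrix p j)ᵀ * samplingMatrix p j * C - Bᵀ * C) x y) ^ 2 ≤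
      ∑ i, (B i x ^ 2 / p i) * C i y ^ 2 / s := fun x y => by
    have h := sum_prod_mul_sum_sub_mean_sq_le hp1 (fun i => B i x * C i y / (s * p i)) s
    simp only [Matrix.sub_apply, transpose_mul_samplingMatrix_mul_apply hp, hmean]
    refine h.trans (le_of_eq ?_)
    rw [Finset.mul_sum]
    refine Finset.sum_congr rfl fun i _ => ?_
    rcases eq_or_ne (p i) 0 with hi | hi
    · simp [hi]
    · field_simp
  simp only [frobNorm_sq]
  calc ∑ j : Fin s → Fin n, (∏ t, p (j t)) *
        ∑ x, ∑ y, ((Bᵀ * (samplingMatrix p j)ᵀ * samplingMatrix p j * C - Bᵀ * C) x y) ^ 2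
      = ∑ x, ∑ y, ∑ j : Fin s → Fin n, (∏ t, p (j t)) *
        ((Bᵀ * (samplingMatrix p j)ᵀ * samplingMatrix p j * C - Bᵀ * C) x y) ^ 2 := by
        simp only [Finset.mul_sum]
        rw [Finset.sum_comm]
        exact Finset.sum_congr rfl fun x _ => Finset.sum_comm
    _ ≤ ∑ x, ∑ y, ∑ i, (B i x ^ 2 / p i) * C i y ^ 2 / s :=
        Finset.sum_le_sum fun x _ => Finset.sum_le_sum fun y _ => hentry x y
    _ = ∑ i, ∑ y, ∑ x, (B i x ^ 2 / p i) * C i y ^ 2 / s := by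
        rw [Finset.sum_comm, Finset.sum_comm (s := (Finset.univ : Finset (Fin n)))]
        exact Finset.sum_congr rfl fun x _ => Finset.sum_comm
    _ = ∑ i, ∑ y, ((∑ x, B i x ^ 2) / p i) * C i y ^ 2 / s := by
        simp only [Finset.sum_div, Finset.sum_mul]
    _ ≤ ∑ i, ∑ y, κ * C i y ^ 2 / s := by
        refine Finset.sum_le_sum fun i _ => Finset.sum_le_sum fun y _ => ?_
        gcongr
        exact div_le_of_le_mul₀ (hp i) hκ (hB i)
    _ = κ / s * ∑ i, ∑ y, C i y ^ 2 := by
        simp only [Finset.mul_sum]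
        exact Finset.sum_congr rfl fun i _ => Finset.sum_congr rfl fun y _ => by ring

lemma sum_filter_frobNorm_gt_le (hp : ∀ i, 0 ≤ p i) (hp1 : ∑ i, p i = 1) (hs : 0 < s)
    {κ : ℝ} (hκ : 0 ≤ κ) {B : Matrix (Fin n) (Fin b) ℝ} (hB : ∀ i, ∑ x, B i x ^ 2 ≤ κ * p i)
    (C : Matrix (Fin n) (Fin c) ℝ) {T : ℝ} (hT : 0 < T) :
    ∑ j : Fin s → Fin n with
        T < frobNorm (Bᵀ * (samplingMatrix p j)ᵀ * samplingMatrix p j * C - Bᵀ * C),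
      ∏ t, p (j t) ≤ κ / s * frobNorm C ^ 2 / T ^ 2 := by
  refine (sum_filter_prod_le_div hp (fun j => sq_nonneg (frobNorm (Bᵀ * (samplingMatrix p j)ᵀ *
    samplingMatrix p j * C - Bᵀ * C))) (pow_pos hT 2)
    fun j hj => pow_le_pow_left₀ hT.le hj.le 2).trans ?_
  gcongr
  exact sum_prod_mul_frobNorm_sq_le hp hp1 hs hκ hB C

/-- The squared norm `‖WC‖²` is the sampled product of the column of row norms of `C` with
itself, so its deviation is an instance of approximate matrix multiplication. -/
lemma sum_filter_abs_frobNorm_sq_sub_gt_le (hp : ∀ i, 0 ≤ p i) (hp1 : ∑ i, p i = 1) (hs : 0 < s)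
    {κ : ℝ} (hκ : 0 ≤ κ) {C : Matrix (Fin n) (Fin c) ℝ} (hC : ∀ i, ∑ x, C i x ^ 2 ≤ κ * p i)
    {T : ℝ} (hT : 0 < T) :
    ∑ j : Fin s → Fin n with T < |frobNorm (samplingMatrix p j * C) ^ 2 - frobNorm C ^ 2|,
      ∏ t, p (j t) ≤ κ / s * frobNorm C ^ 2 / T ^ 2 := by
  set B : Matrix (Fin n) (Fin 1) ℝ := Matrix.of fun i _ => √(∑ y, C i y ^ 2) with hB
  have hBsq : ∀ i x, B i x * B i x = ∑ y, C i y ^ 2 := fun i x =>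
    Real.mul_self_sqrt (Finset.sum_nonneg fun _ _ => sq_nonneg _)
  have hBrow : ∀ i, ∑ x, B i x ^ 2 ≤ κ * p i := fun i => by
    simpa [pow_two, hBsq] using hC i
  have hBB : (Bᵀ * B) 0 0 = frobNorm C ^ 2 := by
    simp only [Matrix.mul_apply, Matrix.transpose_apply, hBsq, frobNorm_sq]
  have hWW : ∀ j : Fin s → Fin n, (Bᵀ * (samplingMatrix p j)ᵀ * samplingMatrix p j * B) 0 0 =
      frobNorm (samplingMatrix p j * C) ^ 2 := fun j => by
    rw [transpose_mul_samplingMatrix_mul_apply hp, frobNorm_sq]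
    refine Finset.sum_congr rfl fun t _ => ?_
    simp only [samplingMatrix_mul_apply, mul_pow, inv_pow,
      Real.sq_sqrt (mul_nonneg (Nat.cast_nonneg s) (hp _)), hBsq, ← Finset.mul_sum]
    rw [div_eq_inv_mul]
  have hfrob : ∀ M : Matrix (Fin 1) (Fin 1) ℝ, frobNorm M = |M 0 0| := fun M => by
    rw [← sq_eq_sq₀ (frobNorm_nonneg _) (abs_nonneg _), frobNorm_sq, sq_abs]
    simp
  have hBC : frobNorm B ^ 2 = frobNorm C ^ 2 := by
    rw [frobNorm_sq_eq_trace, ← hBB]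
    simp [Matrix.trace]
  have h := sum_filter_frobNorm_gt_le hp hp1 hs hκ hBrow B hT
  simp only [hfrob, Matrix.sub_apply, hWW, hBB] at h
  rwa [hBC] at h

lemma posSemidef_vecMulVec_self (u : Fin k → ℝ) : (Matrix.vecMulVec u u).PosSemidef := by
  simpa using Matrix.posSemidef_vecMulVec_self_star u

lemma posSemidef_sum_sq_smul_one_sub_vecMulVec (u : Fin k → ℝ) :
    ((∑ x, u x ^ 2) • (1 : Matrix (Fin k) (Fin k) ℝ) - Matrix.vecMulVec u u).PosSemidef := by
  refine Matrix.PosSemidef.of_dotProduct_mulVec_nonneg ?_ fun z => ?_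
  · refine Matrix.IsHermitian.sub ?_ (posSemidef_vecMulVec_self u).isHermitian
    rw [Matrix.IsHermitian, Matrix.conjTranspose_smul, Matrix.conjTranspose_one, star_trivial]
  · have h := Finset.sum_mul_sq_le_sq_mul_sq Finset.univ u z
    have h1 : star z ⬝ᵥ ((∑ x, u x ^ 2) • (1 : Matrix (Fin k) (Fin k) ℝ) -
        Matrix.vecMulVec u u).mulVec z = (∑ x, u x ^ 2) * ∑ x, z x ^ 2 - (∑ x, u x * z x) ^ 2 := by
      have h2 : (Matrix.vecMulVec u u).mulVec z = (∑ x, u x * z x) • u := by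
        ext x
        simp [Matrix.mulVec, Matrix.vecMulVec_apply, dotProduct, Finset.mul_sum, mul_comm,
          mul_left_comm]
      rw [Matrix.sub_mulVec, h2, Matrix.smul_mulVec, Matrix.one_mulVec, dotProduct_sub,
        dotProduct_smul, dotProduct_smul]
      simp only [star_trivial, dotProduct, smul_eq_mul, pow_two, mul_comm (z _)]
    rw [h1]
    linarith

open scoped Matrix.Norms.L2Operator in
/-- Row sampling approximates the Gram matrix of orthonormal columns in spectral norm. -/
lemma sum_filter_specNorm_gt_le (hp : ∀ i, 0 ≤ p i) (hp1 : ∑ i, p i = 1) (hs : 0 < s)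
    {Y : Matrix (Fin n) (Fin k) ℝ} (hY : Yᵀ * Y = 1) {L : ℝ} (hL : 1 ≤ L)
    (hrow : ∀ i, ∑ x, Y i x ^ 2 ≤ L * p i) {ε : ℝ} (hε : 0 < ε) :
    ∑ j : Fin s → Fin n with
        ε < specNorm (Yᵀ * (samplingMatrix p j)ᵀ * samplingMatrix p j * Y - 1),
      ∏ t, p (j t) ≤ 2 * k * Real.exp (-(s * ε ^ 2 / (2 * (L + L * ε / 3)))) := by
  have hs0 : (0 : ℝ) < s := by exact_mod_cast hs
  have hL0 : 0 < L := by linarith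
  set T : Fin n → Matrix (Fin k) (Fin k) ℝ := fun i => Matrix.vecMulVec (Y i) (Y i) with hT
  set q : Fin n → ℝ := fun i => ∑ x, Y i x ^ 2 with hq
  have hTpsd : ∀ i, (T i).PosSemidef := fun i => posSemidef_vecMulVec_self _
  have hTsymm : ∀ i, (T i).IsSymm := fun i => by
    rw [Matrix.IsSymm, hT, Matrix.transpose_vecMulVec]
  have hTT : ∀ i, T i * T i = q i • T i := fun i => by
    simp only [hT, Matrix.vecMulVec_mul_vecMulVec, hq, dotProduct, pow_two]
    ext x y
    simp [Matrix.vecMulVec_apply, mul_left_comm]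
  have hTsum : ∑ i, T i = 1 := by
    rw [← hY]
    ext x y
    simp [hT, Matrix.sum_apply, Matrix.vecMulVec_apply, Matrix.mul_apply]
  have hpT : ∀ i, (p i * (p i)⁻¹) • T i = T i := fun i => by
    rcases eq_or_ne (p i) 0 with hi | hi
    · have h0 : ∀ x, Y i x = 0 := fun x => by
        have h1 := (Finset.single_le_sum (f := fun x => Y i x ^ 2) (fun _ _ => sq_nonneg _)
          (Finset.mem_univ x)).trans (hrow i)
        rw [hi, mul_zero] at h1
        exact pow_eq_zero_iff two_ne_zero |>.1 (le_antisymm h1 (sq_nonneg _))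
      have : T i = 0 := by ext x y; simp [hT, Matrix.vecMulVec_apply, h0]
      rw [this, smul_zero]
    · rw [mul_inv_cancel₀ hi, one_smul]
  have hqL : ∀ i, (p i)⁻¹ * q i ≤ L := fun i => by
    rw [inv_mul_eq_div]; exact div_le_of_le_mul₀ (hp i) hL0.le (hrow i)
  have hpinv : ∀ i, 0 ≤ (p i)⁻¹ := fun i => inv_nonneg.2 (hp i)
  set X : Fin n → Matrix (Fin k) (Fin k) ℝ := fun i => (p i)⁻¹ • T i - 1 with hX
  have hpX : ∀ i, p i • X i = T i - p i • 1 := fun i => by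
    rw [hX, smul_sub, smul_smul, hpT]
  have hmean : ∑ i, p i • X i = 0 := by
    simp only [hpX, Finset.sum_sub_distrib, hTsum, ← Finset.sum_smul, hp1, one_smul, sub_self]
  have hpXX : ∀ i, p i • (X i * X i) = ((p i)⁻¹ * q i) • T i - (2 : ℝ) • T i + p i • 1 := fun i => by
    rw [← Matrix.smul_mul, hpX, hX]
    have hpT' : ((p i)⁻¹ * p i) • T i = T i := by rw [mul_comm, hpT]
    simp only [mul_sub, sub_mul, Matrix.mul_smul, Matrix.smul_mul, mul_one, one_mul, hTT,
      smul_smul, hpT', two_smul]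
    abel
  have hlow : ∀ i, (L • (1 : Matrix (Fin k) (Fin k) ℝ) + X i).PosSemidef := fun i => by
    have h := (Matrix.PosSemidef.one (n := Fin k) (R := ℝ)).smul (sub_nonneg.2 hL) |>.add
      ((hTpsd i).smul (hpinv i))
    convert h using 1
    simp only [hX, sub_smul, one_smul]
    abel
  have hup : ∀ i, (L • (1 : Matrix (Fin k) (Fin k) ℝ) - X i).PosSemidef := fun i => by
    have h := ((posSemidef_sum_sq_smul_one_sub_vecMulVec (Y i)).smul (hpinv i)).add
      ((Matrix.PosSemidef.one (n := Fin k) (R := ℝ)).smul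
        (show 0 ≤ L - (p i)⁻¹ * q i + 1 by linarith [hqL i]))
    convert h using 1
    rw [hX, add_smul, sub_smul, one_smul, smul_sub, smul_smul]
    simp only [hT, hq]
    abel
  have hvar : (L • (1 : Matrix (Fin k) (Fin k) ℝ) - ∑ i, p i • (X i * X i)).PosSemidef := by
    have h := (Matrix.posSemidef_sum Finset.univ fun i _ =>
      (hTpsd i).smul (sub_nonneg.2 (hqL i))).add (Matrix.PosSemidef.one (n := Fin k) (R := ℝ))
    convert h using 1
    simp only [hpXX, Finset.sum_add_distrib, Finset.sum_sub_distrib, sub_smul, ← Finset.smul_sum,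
      ← Finset.sum_smul, hTsum, hp1, two_smul, one_smul]
    abel
  have hXsymm : ∀ i, (X i).IsSymm := fun i => ((hTsymm i).smul _).sub Matrix.isSymm_one
  have key := matrix_bernstein hp hp1 hXsymm hmean hup hlow hvar hL0 hL0.le hε s
  rw [Fintype.card_fin] at key
  refine le_trans (le_of_eq (Finset.sum_congr (Finset.filter_congr fun j _ => ?_)
    fun _ _ => rfl)) key
  have hsum : ∑ t, X (j t) =
      (s : ℝ) • (Yᵀ * (samplingMatrix p j)ᵀ * samplingMatrix p j * Y - 1) := by
    ext x y
    rw [Matrix.sum_apply, Matrix.smul_apply, Matrix.sub_apply,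
      transpose_mul_samplingMatrix_mul_apply hp]
    simp only [hX, hT, Matrix.sub_apply, Matrix.smul_apply, Matrix.vecMulVec_apply, smul_eq_mul,
      Finset.sum_sub_distrib, Finset.sum_const, Finset.card_univ, Fintype.card_fin, nsmul_eq_mul,
      mul_sub, Finset.mul_sum]
    congr 1
    refine Finset.sum_congr rfl fun t _ => ?_
    rw [div_mul_eq_div_div_swap, mul_div_cancel₀ _ hs0.ne', inv_mul_eq_div]
  rw [hsum, norm_smul, Real.norm_natCast, mul_lt_mul_iff_right₀ hs0]
  rfl

end Sampling

/-! ### The sampling probabilities and the failure probability -/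

section Probability

variable {n d r k : ℕ} {A : Matrix (Fin n) (Fin d) ℝ} {U : Matrix (Fin n) (Fin r) ℝ}
  {σ : Fin r → ℝ} {V : Matrix (Fin d) (Fin r) ℝ}

/-- The inclusion `ℝᵏ → ℝʳ` of the first `k` coordinates, as a matrix. -/
def firstCoords (r k : ℕ) (hk : k ≤ r) : Matrix (Fin r) (Fin k) ℝ :=
  (1 : Matrix (Fin r) (Fin r) ℝ).submatrix id (Fin.castLE hk)

lemma transpose_firstCoords_mul_self (hk : k ≤ r) :
    (firstCoords r k hk)ᵀ * firstCoords r k hk = 1 := by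
  ext a b
  simp [firstCoords, Matrix.mul_apply, Matrix.one_apply, (Fin.castLE_injective hk).eq_iff]

lemma firstCoords_mul_transpose (hk : k ≤ r) :
    firstCoords r k hk * (firstCoords r k hk)ᵀ = blockId r k := by
  ext a b
  rw [Matrix.mul_apply, blockId, Matrix.diagonal_apply]
  simp only [firstCoords, Matrix.transpose_apply, Matrix.submatrix_apply, id, Matrix.one_apply]
  by_cases hab : a = b
  · subst hab
    by_cases ha : (a : ℕ) < k
    · rw [Finset.sum_eq_single ⟨a, ha⟩] <;> simp +contextual [Fin.ext_iff, ha, eq_comm]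
    · have : ∀ c : Fin k, a ≠ Fin.castLE hk c := fun c hc => ha (by simp [hc])
      simp [this, ha]
  · rw [if_neg hab]
    refine Finset.sum_eq_zero fun c _ => ?_
    by_cases h1 : a = Fin.castLE hk c
    · have : b ≠ Fin.castLE hk c := fun h2 => hab (h1.trans h2.symm)
      simp [this]
    · simp [h1]

lemma topCols_eq_mul_firstCoords (U : Matrix (Fin n) (Fin r) ℝ) (hk : k ≤ r) :
    topCols U k hk = U * firstCoords r k hk := by
  ext i a
  simp [topCols, firstCoords, Matrix.mul_apply, Matrix.one_apply]

lemma IsThinSVD.topCols_orthonormal (h : IsThinSVD A U σ V) (hk : k ≤ r) :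
    (topCols U k hk)ᵀ * topCols U k hk = 1 := by
  rw [topCols_eq_mul_firstCoords, Matrix.transpose_mul, Matrix.mul_assoc, ← Matrix.mul_assoc Uᵀ,
    h.left_orthonormal, Matrix.one_mul, transpose_firstCoords_mul_self]

lemma samplingProb_nonneg (hk : k ≤ r) (i : Fin n) : 0 ≤ samplingProb A U σ V k hk i := by
  unfold samplingProb
  have h1 : 0 ≤ ∑ j, topCols U k hk i j ^ 2 := Finset.sum_nonneg fun _ _ => sq_nonneg _
  have h2 : 0 ≤ ∑ j, residual A U σ V k i j ^ 2 := Finset.sum_nonneg fun _ _ => sq_nonneg _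
  positivity

lemma sum_samplingProb (h : IsThinSVD A U σ V) (hk : 1 ≤ k) (hkr : k < r) :
    ∑ i, samplingProb A U σ V k hkr.le i = 1 := by
  have hk0 : (k : ℝ) ≠ 0 := by positivity
  have hR := (frobNorm_residual_pos h hkr).ne'
  have h1 : ∑ i, ∑ j, topCols U k hkr.le i j ^ 2 = k := by
    rw [← frobNorm_sq, frobNorm_sq_eq_trace, h.topCols_orthonormal, Matrix.trace_one,
      Fintype.card_fin]
  simp only [samplingProb, Finset.sum_add_distrib, ← Finset.mul_sum, ← Finset.sum_div]
  rw [h1, ← frobNorm_sq]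
  field_simp
  norm_num

lemma sum_topCols_sq_le (hk : 1 ≤ k) (hkr : k ≤ r) (i : Fin n) :
    ∑ x, topCols U k hkr i x ^ 2 ≤ 2 * k * samplingProb A U σ V k hkr i := by
  have h2 : 0 ≤ (∑ j, residual A U σ V k i j ^ 2) / frobNorm (residual A U σ V k) ^ 2 :=
    div_nonneg (Finset.sum_nonneg fun _ _ => sq_nonneg _) (sq_nonneg _)
  have hk0 : (0 : ℝ) < k := by positivity
  calc ∑ x, topCols U k hkr i x ^ 2
      = 2 * k * (1 / 2 * ((∑ j, topCols U k hkr i j ^ 2) / k)) := by field_simp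
    _ ≤ _ := by
      rw [samplingProb]
      gcongr
      linarith

lemma sum_residual_sq_le (h : IsThinSVD A U σ V) (hkr : k < r) (i : Fin n) :
    ∑ x, residual A U σ V k i x ^ 2 ≤
      2 * frobNorm (residual A U σ V k) ^ 2 * samplingProb A U σ V k hkr.le i := by
  have h2 : 0 ≤ (∑ j, topCols U k hkr.le i j ^ 2) / (k : ℝ) :=
    div_nonneg (Finset.sum_nonneg fun _ _ => sq_nonneg _) (Nat.cast_nonneg k)
  have hR := frobNorm_residual_pos h hkr
  calc ∑ x, residual A U σ V k i x ^ 2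
      = 2 * frobNorm (residual A U σ V k) ^ 2 * (1 / 2 * ((∑ j, residual A U σ V k i j ^ 2) /
          frobNorm (residual A U σ V k) ^ 2)) := by field_simp
    _ ≤ _ := by
      rw [samplingProb]
      gcongr
      linarith

/-- By Eckart–Young it suffices to bound the errors relative to the norm of the residual, which
does not involve `X`. -/
lemma structuralConditions_of_le (h : IsThinSVD A U σ V) (hkr : k < r) {s : ℕ}
    {W : Matrix (Fin s) (Fin n) ℝ} {ε : ℝ} (hε : 0 < ε)
    (h1 : specNorm ((topCols U k hkr.le)ᵀ * Wᵀ * W * topCols U k hkr.le - 1) ≤ ε)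
    (h2 : frobNorm ((topCols U k hkr.le)ᵀ * Wᵀ * W * residual A U σ V k -
      (topCols U k hkr.le)ᵀ * residual A U σ V k) ≤ ε * frobNorm (residual A U σ V k))
    (h3 : frobNorm ((residual A U σ V k)ᵀ * Wᵀ * W * residual A U σ V k -
      (residual A U σ V k)ᵀ * residual A U σ V k) ≤
        ε / √(k : ℝ) * frobNorm (residual A U σ V k) ^ 2)
    (h4 : |frobNorm (W * residual A U σ V k) ^ 2 - frobNorm (residual A U σ V k) ^ 2| ≤
      ε * frobNorm (residual A U σ V k) ^ 2)
    {X : Matrix (Fin d) (Fin (d - k)) ℝ} (hX : Xᵀ * X = 1) :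
    StructuralConditions k ε A U (blockId r k) (residual A U σ V k) W X := by
  have hEY := frobNorm_residual_le h hkr hX
  have hEY2 := pow_le_pow_left₀ (frobNorm_nonneg _) hEY 2
  rw [topCols_eq_mul_firstCoords] at h1 h2
  set E := firstCoords r k hkr.le with hE
  have hEE : Eᵀ * E = 1 := transpose_firstCoords_mul_self hkr.le
  have hnE : specNorm E ≤ 1 := l2_opNorm_le_one_of_transpose_mul_self hEE
  have hnET : specNorm Eᵀ ≤ 1 := (Matrix.l2_opNorm_conjTranspose E).trans_le hnE
  have hmul : ∀ {a b c : ℕ} (M : Matrix (Fin a) (Fin b) ℝ) (N : Matrix (Fin b) (Fin c) ℝ),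
      specNorm (M * N) ≤ specNorm M * specNorm N := fun M N => Matrix.l2_opNorm_mul M N
  have hnn : ∀ {a b : ℕ} (M : Matrix (Fin a) (Fin b) ℝ), 0 ≤ specNorm M := fun {a b} M =>
    let _ : NormedAddCommGroup (Matrix (Fin a) (Fin b) ℝ) := Matrix.instL2OpNormedAddCommGroup
    norm_nonneg M
  rw [← firstCoords_mul_transpose hkr.le, ← hE]
  refine ⟨?_, ?_, ?_, ?_⟩
  · have : E * Eᵀ * Uᵀ * Wᵀ * W * U * (E * Eᵀ) - (E * Eᵀ) ^ 2 =
        E * ((U * E)ᵀ * Wᵀ * W * (U * E) - 1) * Eᵀ := by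
      rw [pow_two, show E * Eᵀ * (E * Eᵀ) = E * (Eᵀ * E) * Eᵀ by simp only [Matrix.mul_assoc], hEE]
      simp only [Matrix.transpose_mul, Matrix.mul_sub, Matrix.sub_mul, Matrix.mul_assoc,
        Matrix.mul_one]
    rw [this]
    calc _ ≤ specNorm E * specNorm ((U * E)ᵀ * Wᵀ * W * (U * E) - 1) * specNorm Eᵀ :=
          (hmul _ _).trans (mul_le_mul_of_nonneg_right (hmul _ _) (hnn _))
      _ ≤ 1 * ε * 1 := by
          have := hnn ((U * E)ᵀ * Wᵀ * W * (U * E) - 1)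
          have := hnn Eᵀ
          gcongr
      _ = ε := by ring
  · have : E * Eᵀ * Uᵀ * Wᵀ * W * residual A U σ V k - E * Eᵀ * Uᵀ * residual A U σ V k =
        E * ((U * E)ᵀ * Wᵀ * W * residual A U σ V k - (U * E)ᵀ * residual A U σ V k) := by
      simp only [Matrix.transpose_mul, Matrix.mul_sub, Matrix.mul_assoc]
    rw [this]
    calc _ ≤ 1 * (ε * frobNorm (residual A U σ V k)) :=
          (frobNorm_mul_le _ _).trans (mul_le_mul hnE h2 (frobNorm_nonneg _) zero_le_one)
      _ ≤ ε * frobNorm (A * X) := by rw [one_mul]; gcongr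
  · exact h3.trans (by gcongr)
  · exact h4.trans (by gcongr)

/-- The union bound for four bad events, for a probability distribution on a finite set. -/
lemma one_sub_le_sum_filter {α : Type*} [Fintype α] {w : α → ℝ} (hw : ∀ a, 0 ≤ w a)
    (hw1 : ∑ a, w a = 1) {g b₁ b₂ b₃ b₄ : α → Prop} [DecidablePred g] [DecidablePred b₁]
    [DecidablePred b₂] [DecidablePred b₃] [DecidablePred b₄] {η : ℝ}
    (h : ∀ a, ¬ b₁ a → ¬ b₂ a → ¬ b₃ a → ¬ b₄ a → g a) (h₁ : ∑ a with b₁ a, w a ≤ η / 4)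
    (h₂ : ∑ a with b₂ a, w a ≤ η / 4) (h₃ : ∑ a with b₃ a, w a ≤ η / 4)
    (h₄ : ∑ a with b₄ a, w a ≤ η / 4) : 1 - η ≤ ∑ a with g a, w a := by
  have key : ∑ a, w a ≤ ∑ a, ((if g a then w a else 0) + (if b₁ a then w a else 0) +
      (if b₂ a then w a else 0) + (if b₃ a then w a else 0) + (if b₄ a then w a else 0)) := by
    refine Finset.sum_le_sum fun a _ => ?_
    have hnn : ∀ (q : Prop) [Decidable q], 0 ≤ if q then w a else 0 := fun q _ => by
      split_ifs
      exacts [hw a, le_rfl]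
    have hg := hnn (g a)
    have hb₁ := hnn (b₁ a)
    have hb₂ := hnn (b₂ a)
    have hb₃ := hnn (b₃ a)
    have hb₄ := hnn (b₄ a)
    by_cases e₁ : b₁ a
    · rw [if_pos e₁]; linarith
    by_cases e₂ : b₂ a
    · rw [if_pos e₂]; linarith
    by_cases e₃ : b₃ a
    · rw [if_pos e₃]; linarith
    by_cases e₄ : b₄ a
    · rw [if_pos e₄]; linarith
    rw [if_pos (h a e₁ e₂ e₃ e₄)]
    linarith
  simp only [Finset.sum_add_distrib, ← Finset.sum_filter, hw1] at key
  linarith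

/-- Each of the four errors is too large with probability at most `δ / 4`, the
spectral one by matrix Bernstein and the three Frobenius ones by Chebyshev's inequality. -/
lemma sum_filter_sampling_ge (h : IsThinSVD A U σ V) (hk : 1 ≤ k) (hkr : k < r) {ε δ : ℝ}
    (hε : 0 < ε) (hδ : 0 < δ) {s : ℕ} (hs : sampleBound k ε δ ≤ s)
    (good : (Fin s → Fin n) → Prop) [DecidablePred good]
    (hgood : ∀ j, (∀ X : Matrix (Fin d) (Fin (d - k)) ℝ, Xᵀ * X = 1 →
      StructuralConditions k ε A U (blockId r k) (residual A U σ V k)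
        (samplingMatrix (samplingProb A U σ V k hkr.le) j) X) → good j) :
    1 - δ ≤ ∑ j with good j, ∏ t, samplingProb A U σ V k hkr.le (j t) := by
  classical
  set R := residual A U σ V k with hR
  set p := samplingProb A U σ V k hkr.le with hp
  have hp0 : ∀ i, 0 ≤ p i := samplingProb_nonneg hkr.le
  have hp1 : ∑ i, p i = 1 := sum_samplingProb h hk hkr
  have hk0 : (0 : ℝ) < k := by positivity
  have hk1 : (1 : ℝ) ≤ k := by exact_mod_cast hk
  have hRpos : 0 < frobNorm R := frobNorm_residual_pos h hkr
  have hrow : ∀ i, ∑ x, R i x ^ 2 ≤ 2 * frobNorm R ^ 2 * p i := sum_residual_sq_le h hkr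
  have hs1 : (1 + ε / 3) * (4 * k * Real.log (16 * (1 + k) / δ) / ε ^ 2) ≤ s :=
    (le_max_left _ _).trans hs
  have hs2 : 8 * k / (δ * ε ^ 2) ≤ s := (le_max_right _ _).trans hs
  have hs0 : (0 : ℝ) < s := lt_of_lt_of_le (by positivity) hs2
  have hsn : 0 < s := by exact_mod_cast hs0
  have hfrac : 2 * k / (s * ε ^ 2) ≤ δ / 4 := by
    rw [div_le_iff₀ (by positivity)] at hs2 ⊢
    nlinarith
  refine one_sub_le_sum_filter (fun j => Finset.prod_nonneg fun t _ => hp0 _)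
    (sum_prod_eq_one hp1 s) (fun j g1 g2 g3 g4 => hgood j fun X hX =>
      structuralConditions_of_le h hkr hε (not_lt.1 g1) (not_lt.1 g2) (not_lt.1 g3) (not_lt.1 g4)
        hX) ?_ ?_ ?_ ?_
  · refine (sum_filter_specNorm_gt_le hp0 hp1 hsn (h.topCols_orthonormal hkr.le)
      (show (1 : ℝ) ≤ 2 * k by linarith) (sum_topCols_sq_le hk hkr.le) hε).trans ?_
    have hlog : Real.log (16 * (1 + k) / δ) ≤ s * ε ^ 2 / (2 * (2 * k + 2 * k * ε / 3)) := by
      rw [le_div_iff₀ (by positivity)]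
      calc _ = (1 + ε / 3) * (4 * k * Real.log (16 * (1 + k) / δ) / ε ^ 2) * ε ^ 2 := by
            field_simp
            ring
        _ ≤ _ := by gcongr
    calc 2 * k * Real.exp (-(s * ε ^ 2 / (2 * (2 * k + 2 * k * ε / 3))))
        ≤ 2 * k * Real.exp (-Real.log (16 * (1 + k) / δ)) := by gcongr
      _ = 2 * k * (δ / (16 * (1 + k))) := by
          rw [Real.exp_neg, Real.exp_log (by positivity), inv_div]
      _ ≤ δ / 4 := by
          rw [← mul_div_assoc, div_le_iff₀ (by positivity)]
          nlinarith
  · refine (sum_filter_frobNorm_gt_le hp0 hp1 hsn (show (0 : ℝ) ≤ 2 * k by positivity)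
      (sum_topCols_sq_le hk hkr.le) R (mul_pos hε hRpos)).trans ?_
    calc _ = 2 * k / (s * ε ^ 2) := by field_simp
      _ ≤ _ := hfrac
  · have hsq : √(k : ℝ) ^ 2 = k := Real.sq_sqrt hk0.le
    have hsqpos : 0 < √(k : ℝ) := Real.sqrt_pos.2 hk0
    refine (sum_filter_frobNorm_gt_le hp0 hp1 hsn (by positivity) hrow R (by positivity)).trans ?_
    calc _ = 2 * √(k : ℝ) ^ 2 / (s * ε ^ 2) := by rw [← hR]; field_simp
      _ = 2 * k / (s * ε ^ 2) := by rw [hsq]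
      _ ≤ _ := hfrac
  · refine (sum_filter_abs_frobNorm_sq_sub_gt_le hp0 hp1 hsn (by positivity) hrow
      (by positivity)).trans ?_
    calc _ = 2 * 1 / (s * ε ^ 2) := by rw [← hR]; field_simp
      _ ≤ 2 * k / (s * ε ^ 2) := by gcongr
      _ ≤ _ := hfrac

/-- The joint law of independent picks from a finite set is the product law. -/
lemma measureReal_picks_eq_sum_filter_prod {Ω α : Type*} [MeasurableSpace Ω] [Fintype α]
    [MeasurableSpace α] [MeasurableSingletonClass α] {P : Measure Ω} [IsProbabilityMeasure P]
    {s : ℕ} {J : Fin s → Ω → α} (hJ : ∀ t, Measurable (J t)) (hind : iIndepFun J P) {p : α → ℝ}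
    (hlaw : ∀ t a, P.real {ω | J t ω = a} = p a) (good : (Fin s → α) → Prop)
    [DecidablePred good] :
    P.real {ω | good fun t => J t ω} = ∑ j with good j, ∏ t, p (j t) := by
  have hset : {ω | good fun t => J t ω} =
      ⋃ j ∈ Finset.univ.filter good, ⋂ t, J t ⁻¹' {j t} := by
    ext ω
    simp only [Set.mem_ofPred_eq, Finset.mem_filter, Finset.mem_univ, true_and, Set.mem_iUnion,
      Set.mem_iInter, Set.mem_preimage, Set.mem_singleton_iff, exists_prop]
    constructor
    · exact fun hω => ⟨_, hω, fun _ => rfl⟩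
    · rintro ⟨j, hj, hω⟩
      rwa [funext hω]
  rw [hset, measureReal_biUnion_finset]
  · refine Finset.sum_congr rfl fun j _ => ?_
    rw [measureReal_def, hind.meas_iInter fun t => ⟨{j t}, measurableSet_singleton _, rfl⟩,
      ENNReal.toReal_prod]
    exact Finset.prod_congr rfl fun t _ => hlaw t (j t)
  · intro j _ j' _ hne
    refine Set.disjoint_left.2 fun ω hω hω' => hne (funext fun t => ?_)
    exact (Set.mem_iInter.1 hω t).symm.trans (Set.mem_iInter.1 hω' t)
  · exact fun j _ => MeasurableSet.iInter fun t => hJ t (measurableSet_singleton _)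

end Probability

/-! ### The growth of the number of rows -/

lemma exists_ceil_sampleBound_le {δ : ℝ} (hδ : 0 < δ) :
    ∃ C : ℝ, 0 < C ∧ ∀ (k : ℕ), 2 ≤ k → ∀ (ε : ℝ), 0 < ε → ε ≤ 1 →
      (⌈sampleBound k ε δ⌉₊ : ℝ) ≤ C * (k * Real.log k / ε ^ 2) := by
  have hlog2 : 1 / 2 ≤ Real.log 2 := by linarith [Real.log_two_gt_d9]
  set M : ℝ := |Real.log (16 / δ)| with hM
  have hM0 : 0 ≤ M := abs_nonneg _
  refine ⟨6 * (2 * M + 2) + 16 / δ + 1, by positivity, fun k hk ε hε hε1 => ?_⟩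
  have hk2 : (2 : ℝ) ≤ k := by exact_mod_cast hk
  have hlogk : 1 / 2 ≤ Real.log k := hlog2.trans (Real.log_le_log two_pos hk2)
  set B : ℝ := k * Real.log k / ε ^ 2 with hB
  have hε2 : ε ^ 2 ≤ 1 := pow_le_one₀ hε.le hε1
  have hB1 : 1 ≤ B := by
    rw [hB, le_div_iff₀ (by positivity)]
    nlinarith
  have h1 : (1 + ε / 3) * (4 * k * Real.log (16 * (1 + k) / δ) / ε ^ 2) ≤ 6 * (2 * M + 2) * B := by
    have hsplit : Real.log (16 * (1 + k) / δ) ≤ (2 * M + 2) * Real.log k := by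
      have : Real.log (16 * (1 + k) / δ) = Real.log (16 / δ) + Real.log (1 + k) := by
        rw [← Real.log_mul (by positivity) (by positivity)]
        congr 1
        ring
      have h' : Real.log (1 + k) ≤ 2 * Real.log k := by
        rw [show 2 * Real.log k = Real.log ((k : ℝ) ^ 2) by rw [Real.log_pow]; norm_num]
        exact Real.log_le_log (by positivity) (by nlinarith)
      rw [this]
      nlinarith [le_abs_self (Real.log (16 / δ))]
    have hnn : 0 ≤ (2 * M + 2) * Real.log k := by positivity
    calc _ ≤ (1 + ε / 3) * (4 * k * ((2 * M + 2) * Real.log k) / ε ^ 2) := by gcongr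
      _ ≤ (3 / 2) * (4 * k * ((2 * M + 2) * Real.log k) / ε ^ 2) := by
          gcongr
          linarith
      _ = _ := by rw [hB]; ring
  have h2 : 8 * k / (δ * ε ^ 2) ≤ 16 / δ * B := by
    have : 16 / δ * B = 8 * k * (2 * Real.log k) / (δ * ε ^ 2) := by
      rw [hB]; field_simp; ring
    rw [this]
    exact div_le_div_of_nonneg_right (le_mul_of_one_le_right (by positivity) (by linarith))
      (by positivity)
  have hpos : 0 ≤ sampleBound k ε δ := (show 0 ≤ 8 * k / (δ * ε ^ 2) by positivity).trans
    (le_max_right _ _)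
  have hle : sampleBound k ε δ ≤ (6 * (2 * M + 2) + 16 / δ) * B := by
    have : 0 ≤ 16 / δ * B := by positivity
    have : 0 ≤ 6 * (2 * M + 2) * B := by positivity
    exact max_le (by linarith) (by linarith)
  calc (⌈sampleBound k ε δ⌉₊ : ℝ) ≤ sampleBound k ε δ + 1 := (Nat.ceil_lt_add_one hpos).le
    _ ≤ (6 * (2 * M + 2) + 16 / δ + 1) * B := by linarith

end PCP

theorem mainTheorem2 (δ : ℝ) (hδ : 0 < δ) :
    -- sampling guarantee
    (∀ (n d r : ℕ) (A : Matrix (Fin n) (Fin d) ℝ) (U : Matrix (Fin n) (Fin r) ℝ)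
      (σ : Fin r → ℝ) (V : Matrix (Fin d) (Fin r) ℝ), PCP.IsThinSVD A U σ V →
      ∀ (k : ℕ) (_ : 1 ≤ k) (hkr : k < r),
        -- the `p_i` form a probability distribution
        ((∀ i, 0 ≤ PCP.samplingProb A U σ V k hkr.le i) ∧
          ∑ i, PCP.samplingProb A U σ V k hkr.le i = 1) ∧
        ∀ (ε : ℝ), 0 < ε → ∀ (s : ℕ), PCP.sampleBound k ε δ ≤ (s : ℝ) →
          -- `J 0, …, J (s - 1)` are independent picks with `P(J t = a) = p_a`
          ∀ (Ω : Type*) [MeasurableSpace Ω] (P : Measure Ω) [IsProbabilityMeasure P]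
            (J : Fin s → Ω → Fin n), (∀ t, Measurable (J t)) → iIndepFun J P →
            (∀ t a, P.real {ω | J t ω = a} = PCP.samplingProb A U σ V k hkr.le a) →
            1 - δ ≤ P.real {ω |
              (∀ X : Matrix (Fin d) (Fin (d - k)) ℝ, Xᵀ * X = 1 →
                PCP.StructuralConditions k ε A U (PCP.blockId r k) (PCP.residual A U σ V k)
                  (PCP.samplingMatrix (PCP.samplingProb A U σ V k hkr.le) (fun t => J t ω)) X) ∧
              PCP.IsProjectionCostPreserving A
                (PCP.samplingMatrix (PCP.samplingProb A U σ V k hkr.le) (fun t => J t ω))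
                k (5 * ε)}) ∧
    -- the least admissible number of rows is `O(k ln k / ε²)` for fixed `δ`
    (∃ C : ℝ, 0 < C ∧ ∀ (k : ℕ), 2 ≤ k → ∀ (ε : ℝ), 0 < ε → ε ≤ 1 →
      (⌈PCP.sampleBound k ε δ⌉₊ : ℝ) ≤ C * (k * Real.log k / ε ^ 2)) := by
  refine ⟨fun n d r A U σ V h k hk hkr => ⟨⟨PCP.samplingProb_nonneg hkr.le,
    PCP.sum_samplingProb h hk hkr⟩, fun ε hε s hs Ω _ P _ J hJ hind hlaw => ?_⟩,
    PCP.exists_ceil_sampleBound_le hδ⟩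
  classical
  rw [PCP.measureReal_picks_eq_sum_filter_prod hJ hind hlaw (fun j =>
    (∀ X : Matrix (Fin d) (Fin (d - k)) ℝ, Xᵀ * X = 1 →
      PCP.StructuralConditions k ε A U (PCP.blockId r k) (PCP.residual A U σ V k)
        (PCP.samplingMatrix (PCP.samplingProb A U σ V k hkr.le) j) X) ∧
      PCP.IsProjectionCostPreserving A
        (PCP.samplingMatrix (PCP.samplingProb A U σ V k hkr.le) j) k (5 * ε))]
  exact PCP.sum_filter_sampling_ge h hk hkr hε hδ hs _ fun j hj =>
    ⟨hj, fun X hX => (hj X hX).abs_sub_le h hk hkr hε hX⟩
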